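/- Conventions. A dataset is a finite set $X$ of $n$ distinct points of $\mathbb{R}^d$ (Euclidean distance), with unit weights. For a weighted set $S$ with weights $w_S \ge 0$, centers $C \in (\mathbb{R}^d)^k$ and an integer $z \ge 1$, let $\mathrm{cost}_z(S,C) = \sum_{x \in S} w_S(x)\,\mathrm{dist}(x,C)^z$, and for real $h \ge 0$ let $\mathrm{cost}_z^{(h)}(S,C)$ be the minimum of $\mathrm{cost}_z(S-Y,C)$ over all weighted subsets $Y$ of $S$ (that is, $0 \le w_Y \le w_S$) of total weight $h$ (it is $0$ if $h$ exceeds the total weight of $S$). An $\varepsilon$-coreset of $X$ for $(k,z,m)$-clustering is a weighted set $S \subseteq X$ such that $$(1-\varepsilon)\,\mathrm{cost}_z^{(h)}(X,C) \le \mathrm{cost}_z^{(h)}(S,C) \le (1+\varepsilon)\,\mathrm{cost}_z^{(h)}(X,C)\quad\text{for all } C \in (\mathbb{R}^d)^k \text{ and all real } 0 \le h \le m.$$ For $m=0$ it is called an $\varepsilon$-coreset for vanilla $(k,z)$-clustering. The size of $S$ is its number of points (of nonzero weight). Write $L = \max\{1, \log(km\varepsilon^{-1})\}$. An algorithm is a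 finite computation tree over the reals (exact operations $+,-,\times,/,\sqrt{\cdot}$, comparisons, real constants), possibly with calls to an oracle; there is one tree for each choice of the parameters $d,k,z,m,n,\varepsilon$. Theorem. There is an absolute constant $c \in \mathbb{N}$ such that for all integers $d,k,z,m \ge 1$, $n \ge 0$ and all $0<\varepsilon<1$ there is a deterministic oracle algorithm $P$ with the following property. Let $N$ be any function, and let $\mathcal{A}$ be any (deterministic) procedure that, for all $d',k' \ge 1$ and $0<\varepsilon'<1$, constructs for every dataset in $\mathbb{R}^{d'}$ an $\varepsilon'$-coreset for vanilla $(k',z)$-clustering of size at most $N(d',k',\varepsilon'^{-1})$. Then $P$, using $\mathcal{A}$ as a black box, constructs for every $n$-point dataset in $\mathbb{R}^d$ an $\varepsilon$-coreset for $(k,z,m)$-clustering of size at most $$\min\Big\{N\big(d,\,k,\,c\varepsilon^{-1}\big) + A_1,\;\; N\big(cd,\,\lceil c\,k L^2\rceil,\,c\varepsilon^{-1}\big) + A_2\Big\},$$ where $A_1 = c\,z^{cz}\cdot km\varepsilon^{-1}$ and $A_2 = c\,z^{cz}\cdot m\,\varepsilon^{-2z}L^z$. -/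

import Mathlib

namespace RobustCoreset

noncomputable section

/-! ### Clustering with outliers and coresets

A dataset with `n` points is an injective family `x : ι → V` indexed by a finite type.
A weighted subset of it is a weight function `w : ι → ℝ`, `0 ≤ w`; the points that are not in the
subset are those of weight `0`. -/

/-- The distance `dist(p, C) = min_{c ∈ C} dist(p, c)` to the `k` centers `C` (where `1 ≤ k`). -/
def centerDist {V : Type*} [PseudoMetricSpace V] {k : ℕ} (p : V) (C : Fin k → V) : ℝ :=
  ⨅ j, dist p (C j)

/-- The weighted objective `cost_z(w, C) = ∑ w(x) dist(x, C)^z` of `(k,z)`-clustering. -/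
def cost {V ι : Type*} [PseudoMetricSpace V] [Fintype ι] {k : ℕ} (z : ℕ) (x : ι → V) (w : ι → ℝ)
    (C : Fin k → V) : ℝ :=
  ∑ i, w i * centerDist (x i) C ^ z

/-- The weighted subsets `y` of the weighted set `w` of total weight `h`; if `h` exceeds the total
weight of `w`, the only candidate is `w` itself (everything is removed). -/
def outlierSets {ι : Type*} [Fintype ι] (w : ι → ℝ) (h : ℝ) : Set (ι → ℝ) :=
  {y | (∀ i, 0 ≤ y i ∧ y i ≤ w i) ∧ ∑ i, y i = min h (∑ i, w i)}

/-- The robust objective `cost_z^{(h)}(w, C)`: the minimum of `cost_z(w - y, C)` over all weighted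
subsets `y` of total weight `h`. -/
def robustCost {V ι : Type*} [PseudoMetricSpace V] [Fintype ι] {k : ℕ} (z : ℕ) (h : ℝ)
    (x : ι → V) (w : ι → ℝ) (C : Fin k → V) : ℝ :=
  sInf ((fun y : ι → ℝ => cost z x (fun i => w i - y i) C) '' outlierSets w h)

/-- The weighted subset `w` of the dataset `x` is an `ε`-coreset for `(k,z,m)`-clustering: it
preserves the robust objective up to a factor `1 ± ε` for all `k` centers and for all real numbers
`0 ≤ h ≤ m` of outliers. The dataset itself carries unit weights. -/
def IsCoreset {V ι : Type*} [PseudoMetricSpace V] [Fintype ι] (k z m : ℕ) (ε : ℝ) (x : ι → V)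
    (w : ι → ℝ) : Prop :=
  (∀ i, 0 ≤ w i) ∧
    ∀ (C : Fin k → V) (h : ℝ), 0 ≤ h → h ≤ (m : ℝ) →
      (1 - ε) * robustCost z h x (fun _ => 1) C ≤ robustCost z h x w C ∧
        robustCost z h x w C ≤ (1 + ε) * robustCost z h x (fun _ => 1) C

/-- The size of a weighted set: the number of its points. -/
def size {ι : Type*} (w : ι → ℝ) : ℕ := {i | w i ≠ 0}.ncard

/-! ### Algorithms -/

/-- The input-output behaviour of a coreset construction in Euclidean spaces: from the dimension
`d`, the number of centers `k`, the accuracy `ε` and the points `x 0, …, x (n-1)` it produces the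
weights of these points. -/
abbrev Construction : Type :=
  (d k : ℕ) → (ε : ℝ) → (n : ℕ) → (Fin n → EuclideanSpace ℝ (Fin d)) → Fin n → ℝ

/-- The construction `A` builds `ε`-coresets of size at most `N d k ε⁻¹` for vanilla
`(k,z)`-clustering (no outliers), for every dataset in every Euclidean space. -/
def IsVanillaConstruction (z : ℕ) (N : ℕ → ℕ → ℝ → ℝ) (A : Construction) : Prop :=
  ∀ (d k : ℕ) (ε : ℝ), 1 ≤ d → 1 ≤ k → 0 < ε → ε < 1 →
    ∀ (n : ℕ) (x : Fin n → EuclideanSpace ℝ (Fin d)), Function.Injective x →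
      IsCoreset k z 0 ε x (A d k ε n x) ∧ (size (A d k ε n x) : ℝ) ≤ N d k ε⁻¹

/-- Deterministic algorithms over exact real arithmetic, with an oracle for a coreset construction
(finite algebraic computation trees with oracle calls). The registers are numbered by `ℕ` and hold
real numbers. The data can only be accessed by arithmetic operations, square roots, comparisons
and oracle calls. `n` is the number of real numbers that the algorithm returns. -/
inductive Algorithm (n : ℕ) : Type
  /-- return the contents of the registers `out 0, …, out (n-1)` -/
  | halt (out : Fin n → ℕ) : Algorithm n
  /-- store the constant `c` in register `r` -/
  | const (r : ℕ) (c : ℝ) (next : Algorithm n) : Algorithm n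
  /-- store the sum of registers `a` and `b` in register `r`; similarly for the next three -/
  | add (r a b : ℕ) (next : Algorithm n) : Algorithm n
  | sub (r a b : ℕ) (next : Algorithm n) : Algorithm n
  | mul (r a b : ℕ) (next : Algorithm n) : Algorithm n
  | div (r a b : ℕ) (next : Algorithm n) : Algorithm n
  /-- store the square root of register `a` in register `r` -/
  | sqrt (r a : ℕ) (next : Algorithm n) : Algorithm n
  /-- continue with `yes` if register `a` is at most register `b`, otherwise with `no` -/
  | branch (a b : ℕ) (yes no : Algorithm n) : Algorithm n
  /-- run the oracle in dimension `d` with `k` centers and accuracy `ε` on the `l` points whose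
  coordinates are in the registers `pt`, and store the `l` weights in the registers
  `r, …, r + l - 1` -/
  | call (r d k : ℕ) (ε : ℝ) (l : ℕ) (pt : Fin l → Fin d → ℕ) (next : Algorithm n) : Algorithm n

/-- The values returned by an algorithm with oracle `A`, started with register contents `s`. -/
def Algorithm.run {n : ℕ} (A : Construction) : Algorithm n → (ℕ → ℝ) → Fin n → ℝ
  | .halt out, s => fun i => s (out i)
  | .const r c next, s => next.run A (Function.update s r c)
  | .add r a b next, s => next.run A (Function.update s r (s a + s b))
  | .sub r a b next, s => next.run A (Function.update s r (s a - s b))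
  | .mul r a b next, s => next.run A (Function.update s r (s a * s b))
  | .div r a b next, s => next.run A (Function.update s r (s a / s b))
  | .sqrt r a next, s => next.run A (Function.update s r (Real.sqrt (s a)))
  | .branch a b yes no, s => open Classical in if s a ≤ s b then yes.run A s else no.run A s
  | .call r d k ε l pt next, s => next.run A fun q =>
      if h : r ≤ q ∧ q < r + l then
        A d k ε l (fun i => WithLp.toLp 2 fun j => s (pt i j)) ⟨q - r, by omega⟩
      else s q

/-- The initial register contents: the `j`-th coordinate of the `i`-th point is in register
`j + d * i`, all other registers hold `0`. -/
def load {n d : ℕ} (x : Fin n → EuclideanSpace ℝ (Fin d)) : ℕ → ℝ := fun q =>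
  if h : q < n * d then x (finProdFinEquiv.symm ⟨q, h⟩).1 (finProdFinEquiv.symm ⟨q, h⟩).2 else 0

/-! ### The size bounds -/

/-- `max(1, log(k m ε⁻¹))`. -/
def logTerm (k m : ℕ) (ε : ℝ) : ℝ := max 1 (Real.log (k * m * ε⁻¹))

/-- `N(d, k, c ε⁻¹) + c z^{c z} · k m ε⁻¹`. -/
def sizeBound₁ (c : ℕ) (N : ℕ → ℕ → ℝ → ℝ) (d k z m : ℕ) (ε : ℝ) : ℝ :=
  N d k (c * ε⁻¹) + c * (z : ℝ) ^ (c * z) * (k * m * ε⁻¹)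

/-- `N(c d, ⌈c k log²(k m ε⁻¹)⌉, c ε⁻¹) + c z^{c z} · m ε^{-2z} log^z(k m ε⁻¹)`. -/
def sizeBound₂ (c : ℕ) (N : ℕ → ℕ → ℝ → ℝ) (d k z m : ℕ) (ε : ℝ) : ℝ :=
  N (c * d) ⌈c * k * logTerm k m ε ^ 2⌉₊ (c * ε⁻¹) +
    c * (z : ℝ) ^ (c * z) * (m * ε⁻¹ ^ (2 * z) * logTerm k m ε ^ z)

end

end RobustCoreset

/-! Let `b` be an optimal solution among those with centers in the dataset and at most `m` whole
outliers, and let `V` be its cost. Then `V ≤ 2 ^ z * robustCost` for all centers and all `h ≤ m`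
(`IsOptimal.le_robustCost`), so additive errors of order `ε V / 2 ^ z` are harmless. The outliers of
`b` and the few points with connection cost above a threshold `ρ V` are kept with weight 1
(`card_compl_core_le`). What remains are `k` clusters of small radius, and these are handed to the
oracle.

For the first bound, the points in clusters with fewer than about `3 ^ z m / ε` points are kept too.
In a larger cluster a single point costs little more than the cluster average, so removing mass at
most `m` there hardly matters, and a vanilla coreset is good enough
(`robustCost_approx_of_large_clusters`).

For the second bound, small clusters are too many to be kept. They are merged into pieces whose
radius is larger by a factor of order `log k / ε`, colored with `O(log k)` colors so that pieces of
equal color are far apart (`exists_sparse_partition`). The pieces are lifted to very different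
heights in an additional dimension. A vanilla coreset of the lifted set for `O(k log k)` centers
nearly preserves the mass of every piece (`mass_approx`). It also nearly preserves the cost of any
family of pieces near given centers, because at short range a center meets only one piece of each
color (`exists_lifted_centers`, `near_cost_approx`). The masses are then made exact by rescaling.
Outliers can now be transferred piece by piece (`robustCost_le_of_mass_eq`): on pieces far from the
centers the distance is nearly constant and only mass counts, and on near pieces a mass of at most
`m` is moved over short distances.

As to computability, `b`, the cores and the sparse partition range over finite types and are
characterized by comparisons of `z`-th powers of distances, so a computation tree can search for
them (`Solves.search`). Both constructions are run, and the smaller result is returned. -/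

namespace RobustCoreset

noncomputable section

/-! ### Building algorithms

`E` is a type of environments: an environment `e` determines an oracle `orc e` and the input. -/

section Solves

variable {E : Type*} {n : ℕ} {orc : E → Construction} {K K' : Set (E → ℝ)}
  {R R' : E → (Fin n → ℝ) → Prop} {f g : E → ℝ}

/-- If the values of the functions in `K` are stored in registers, in any layout, then there is
an algorithm whose output satisfies the specification `R` in every environment. -/
def Solves (orc : E → Construction) (K : Set (E → ℝ)) (R : E → (Fin n → ℝ) → Prop) : Prop :=
  ∀ (M : ℕ) (l : ℕ → E → ℝ), (∀ f ∈ K, ∃ i < M, l i = f) →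
    ∃ P : Algorithm n, ∀ (e : E) (s : ℕ → ℝ), (∀ i < M, s i = l i e) → R e (P.run (orc e) s)

theorem Solves.mono (h : Solves orc K R) (hK : K ⊆ K') : Solves orc K' R :=
  fun M l hl => h M l fun f hf => hl f (hK hf)

theorem Solves.weaken (h : Solves orc K R) (hR : ∀ e o, R e o → R' e o) : Solves orc K R' := by
  intro M l hl
  obtain ⟨P, hP⟩ := h M l hl
  exact ⟨P, fun e s hs => hR _ _ (hP e s hs)⟩

theorem Solves.halt (out : Fin n → E → ℝ) (hout : ∀ i, out i ∈ K)
    (hR : ∀ e, R e fun i => out i e) : Solves orc K R := by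
  intro M l hl
  choose r hr hlr using fun i => hl _ (hout i)
  refine ⟨.halt r, fun e s hs => ?_⟩
  have : (Algorithm.halt r).run (orc e) s = fun i => out i e := by
    funext i
    simp only [Algorithm.run]
    rw [hs _ (hr i), hlr i]
  rw [this]
  exact hR e

/-- Register `M` is the first one without prescribed content, so writing to it destroys no stored
value. -/
theorem Solves.step (op : ∀ (M : ℕ) (l : ℕ → E → ℝ), (∀ f ∈ K, ∃ i < M, l i = f) →
      ∃ mk : Algorithm n → Algorithm n, ∀ P e s, (∀ i < M, s i = l i e) →
        (mk P).run (orc e) s = P.run (orc e) (Function.update s M (f e)))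
    (h : Solves orc (insert f K) R) : Solves orc K R := by
  intro M l hl
  obtain ⟨mk, hmk⟩ := op M l hl
  obtain ⟨P, hP⟩ := h (M + 1) (Function.update l M f) (by
    rintro f' (rfl | hf')
    · exact ⟨M, by omega, by simp⟩
    · obtain ⟨i, hi, rfl⟩ := hl f' hf'
      exact ⟨i, by omega, by rw [Function.update_of_ne (by omega)]⟩)
  refine ⟨mk P, fun e s hs => ?_⟩
  rw [hmk P e s hs]
  refine hP e _ fun i hi => ?_
  rcases eq_or_ne i M with rfl | h'
  · simp
  · rw [Function.update_of_ne h', Function.update_of_ne h']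
    exact hs i (by omega)

/-- The functions that can be computed from those in `K` by straight-line programs. -/
inductive Computable (K : Set (E → ℝ)) : (E → ℝ) → Prop
  | of_mem {f : E → ℝ} : f ∈ K → Computable K f
  | const (c : ℝ) : Computable K fun _ => c
  | add {f g : E → ℝ} : Computable K f → Computable K g → Computable K fun e => f e + g e
  | sub {f g : E → ℝ} : Computable K f → Computable K g → Computable K fun e => f e - g e
  | mul {f g : E → ℝ} : Computable K f → Computable K g → Computable K fun e => f e * g e
  | div {f g : E → ℝ} : Computable K f → Computable K g → Computable K fun e => f e / g e
  | sqrt {f : E → ℝ} : Computable K f → Computable K fun e => Real.sqrt (f e)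

theorem Computable.mono (h : Computable K f) (hK : K ⊆ K') : Computable K' f := by
  induction h with
  | of_mem h => exact .of_mem (hK h)
  | const c => exact .const c
  | add _ _ h₁ h₂ => exact .add h₁ h₂
  | sub _ _ h₁ h₂ => exact .sub h₁ h₂
  | mul _ _ h₁ h₂ => exact .mul h₁ h₂
  | div _ _ h₁ h₂ => exact .div h₁ h₂
  | sqrt _ h => exact .sqrt h

theorem Computable.sum {ι : Type*} (s : Finset ι) {f : ι → E → ℝ}
    (h : ∀ i ∈ s, Computable K (f i)) : Computable K fun e => ∑ i ∈ s, f i e := by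
  classical
  induction s using Finset.induction_on with
  | empty => simpa using Computable.const (K := K) 0
  | insert a s ha ih =>
    simp only [Finset.sum_insert ha]
    exact .add (h a (by simp)) (ih fun i hi => h i (by simp [hi]))

theorem Computable.pow (h : Computable K f) (z : ℕ) : Computable K fun e => f e ^ z := by
  induction z with
  | zero => simpa using Computable.const (K := K) 1
  | succ z ih => simpa only [pow_succ] using ih.mul h

theorem Solves.computable (hf : Computable K f) (h : Solves orc (insert f K) R) :
    Solves orc K R := by
  -- Operands are computed one after the other. The claim for all larger `K'` keeps the first
  -- operand stored while the second one is computed.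
  suffices H : ∀ K', K ⊆ K' → ∀ R : E → (Fin n → ℝ) → Prop,
      Solves orc (insert f K') R → Solves orc K' R from H K subset_rfl R h
  clear h
  have insert_mono : ∀ {K : Set (E → ℝ)} {f g h : E → ℝ},
      insert h K ⊆ insert h (insert g (insert f K)) := fun {K f g h} =>
    Set.insert_subset_insert ((Set.subset_insert _ _).trans (Set.subset_insert _ _))
  induction hf with
  | of_mem hf =>
    intro K' hK R h
    rwa [Set.insert_eq_of_mem (hK hf)] at h
  | const c =>
    intro K' hK R h
    refine h.step fun M l hl => ⟨.const M c, fun P e s hs => ?_⟩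
    simp [Algorithm.run]
  | @add f g _ _ hf hg =>
    intro K' hK R h
    refine hf K' hK R (hg _ (hK.trans (Set.subset_insert _ _)) R
      ((h.mono insert_mono).step fun M l hl => ?_))
    obtain ⟨i, hi, rfl⟩ := hl f (by simp)
    obtain ⟨j, hj, rfl⟩ := hl g (by simp)
    exact ⟨.add M i j, fun P e s hs => by simp [Algorithm.run, hs i hi, hs j hj]⟩
  | @sub f g _ _ hf hg =>
    intro K' hK R h
    refine hf K' hK R (hg _ (hK.trans (Set.subset_insert _ _)) R
      ((h.mono insert_mono).step fun M l hl => ?_))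
    obtain ⟨i, hi, rfl⟩ := hl f (by simp)
    obtain ⟨j, hj, rfl⟩ := hl g (by simp)
    exact ⟨.sub M i j, fun P e s hs => by simp [Algorithm.run, hs i hi, hs j hj]⟩
  | @mul f g _ _ hf hg =>
    intro K' hK R h
    refine hf K' hK R (hg _ (hK.trans (Set.subset_insert _ _)) R
      ((h.mono insert_mono).step fun M l hl => ?_))
    obtain ⟨i, hi, rfl⟩ := hl f (by simp)
    obtain ⟨j, hj, rfl⟩ := hl g (by simp)
    exact ⟨.mul M i j, fun P e s hs => by simp [Algorithm.run, hs i hi, hs j hj]⟩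
  | @div f g _ _ hf hg =>
    intro K' hK R h
    refine hf K' hK R (hg _ (hK.trans (Set.subset_insert _ _)) R
      ((h.mono insert_mono).step fun M l hl => ?_))
    obtain ⟨i, hi, rfl⟩ := hl f (by simp)
    obtain ⟨j, hj, rfl⟩ := hl g (by simp)
    exact ⟨.div M i j, fun P e s hs => by simp [Algorithm.run, hs i hi, hs j hj]⟩
  | @sqrt f _ hf =>
    intro K' hK R h
    refine hf K' hK R ((h.mono (Set.insert_subset_insert (Set.subset_insert _ _))).step
      fun M l hl => ?_)
    obtain ⟨i, hi, rfl⟩ := hl f (by simp)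
    exact ⟨.sqrt M i, fun P e s hs => by simp [Algorithm.run, hs i hi]⟩

/-- Finitely many computable functions may be assumed to be stored in registers. -/
theorem Solves.computable_range {ι : Type*} [Fintype ι] {f : ι → E → ℝ}
    (hf : ∀ i, Computable K (f i)) (h : Solves orc (K ∪ Set.range f) R) : Solves orc K R := by
  classical
  suffices H : ∀ t : Finset ι, Solves orc (K ∪ f '' t) R → Solves orc K R from
    H Finset.univ (by simpa using h)
  intro t
  induction t using Finset.induction_on with
  | empty => simp
  | insert a t _ ih =>
    intro h
    refine ih (.computable ((hf a).mono Set.subset_union_left) ?_)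
    rwa [Finset.coe_insert, Set.image_insert_eq, Set.union_insert] at h

theorem Solves.output (out : Fin n → E → ℝ) (hout : ∀ i, Computable K (out i))
    (hR : ∀ e, R e fun i => out i e) : Solves orc K R :=
  .computable_range hout (.halt out (fun i => .inr ⟨i, rfl⟩) hR)

/-- The property `p` of environments can be tested by comparisons. -/
def Testable (n : ℕ) (orc : E → Construction) (K : Set (E → ℝ)) (p : E → Prop) : Prop :=
  ∀ (K' : Set (E → ℝ)) (R : E → (Fin n → ℝ) → Prop), K ⊆ K' →
    Solves orc K' (fun e o => p e → R e o) → Solves orc K' (fun e o => ¬ p e → R e o) →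
      Solves orc K' R

variable {p q : E → Prop}

theorem Testable.const (p : Prop) : Testable n orc K fun _ => p := by
  intro K' R _ h₁ h₂
  by_cases hp : p
  · exact h₁.weaken fun e o h => h hp
  · exact h₂.weaken fun e o h => h hp

theorem Testable.le (hf : Computable K f) (hg : Computable K g) :
    Testable n orc K fun e => f e ≤ g e := by
  intro K' R hK h₁ h₂
  refine .computable (hf.mono hK) (.computable (hg.mono (hK.trans (Set.subset_insert _ _))) ?_)
  have hK' : K' ⊆ insert g (insert f K') := (Set.subset_insert _ _).trans (Set.subset_insert _ _)
  intro M l hl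
  obtain ⟨P₁, hP₁⟩ := h₁.mono hK' M l hl
  obtain ⟨P₂, hP₂⟩ := h₂.mono hK' M l hl
  obtain ⟨i, hi, rfl⟩ := hl f (by simp)
  obtain ⟨j, hj, rfl⟩ := hl g (by simp)
  refine ⟨.branch i j P₁ P₂, fun e s hs => ?_⟩
  by_cases h : l i e ≤ l j e
  · have : (Algorithm.branch i j P₁ P₂).run (orc e) s = P₁.run (orc e) s := by
      simp [Algorithm.run, hs i hi, hs j hj, h]
    exact this ▸ hP₁ e s hs h
  · have : (Algorithm.branch i j P₁ P₂).run (orc e) s = P₂.run (orc e) s := by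
      simp [Algorithm.run, hs i hi, hs j hj, h]
    exact this ▸ hP₂ e s hs h

theorem Testable.not (hp : Testable n orc K p) : Testable n orc K fun e => ¬ p e := by
  intro K' R hK h₁ h₂
  exact hp K' R hK (h₂.weaken fun e o h h' => h (not_not.2 h')) h₁

theorem Testable.and (hp : Testable n orc K p) (hq : Testable n orc K q) :
    Testable n orc K fun e => p e ∧ q e := by
  intro K' R hK h₁ h₂
  refine hp K' R hK (hq K' _ hK (h₁.weaken fun e o h h' h'' => h ⟨h'', h'⟩)
    (h₂.weaken fun e o h h' h'' => h fun hh => h' hh.2))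
    (h₂.weaken fun e o h h' => h fun hh => h' hh.1)

theorem Testable.congr (hp : Testable n orc K p) (h : ∀ e, p e ↔ q e) : Testable n orc K q := by
  have : p = q := funext fun e => propext (h e)
  exact this ▸ hp

theorem Testable.imp (hp : Testable n orc K p) (hq : Testable n orc K q) :
    Testable n orc K fun e => p e → q e :=
  (hp.and hq.not).not.congr fun e => by tauto

theorem Testable.iff (hp : Testable n orc K p) (hq : Testable n orc K q) :
    Testable n orc K fun e => p e ↔ q e :=
  ((hp.imp hq).and (hq.imp hp)).congr fun e => by tauto

theorem Testable.eq (hf : Computable K f) (hg : Computable K g) :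
    Testable n orc K fun e => f e = g e :=
  ((Testable.le hf hg).and (.le hg hf)).congr fun _ => le_antisymm_iff.symm

theorem Testable.forall {ι : Type*} [Finite ι] {p : ι → E → Prop}
    (h : ∀ i, Testable n orc K (p i)) : Testable n orc K fun e => ∀ i, p i e := by
  classical
  have := Fintype.ofFinite ι
  suffices H : ∀ t : Finset ι, Testable n orc K fun e => ∀ i ∈ t, p i e from
    (H Finset.univ).congr fun e => by simp
  intro t
  induction t using Finset.induction_on with
  | empty => exact (Testable.const True).congr fun e => by simp
  | insert a t _ ih => exact ((h a).and ih).congr fun e => by simp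

/-- An algorithm can search for an object of a finite type which satisfies a testable property. -/
theorem Solves.search {β : Type*} [Finite β] {Q : β → E → Prop}
    (hQ : ∀ b, Testable n orc K (Q b)) (hex : ∀ e, ∃ b, Q b e)
    (h : ∀ b, Solves orc K fun e o => Q b e → R e o) : Solves orc K R := by
  classical
  have := Fintype.ofFinite β
  suffices H : ∀ t : Finset β, Solves orc K fun e o => (∃ b ∈ t, Q b e) → R e o from
    (H Finset.univ).weaken fun e o h => h (by simpa using hex e)
  intro t
  induction t using Finset.induction_on with
  | empty =>
    -- No candidate is left, so the specification is vacuous and any output will do.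
    exact .output (fun _ _ => 0) (fun _ => .const 0) fun e h => absurd h (by simp)
  | insert a t _ ih =>
    refine hQ a K _ subset_rfl ((h a).weaken fun e o h h' _ => h h') (ih.weaken ?_)
    intro e o h h' ⟨b, hb, hbe⟩
    rcases Finset.mem_insert.1 hb with rfl | hb
    · exact absurd hbe h'
    · exact h ⟨b, hb, hbe⟩

theorem Solves.call {d l : ℕ} (k : ℕ) (ε : ℝ) (y : Fin l → E → EuclideanSpace ℝ (Fin d))
    (hy : ∀ i j, Computable K fun e => y i e j)
    (h : Solves orc (K ∪ Set.range fun i e => orc e d k ε l (fun i => y i e) i) R) :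
    Solves orc K R := by
  refine .computable_range (f := fun (ij : Fin l × Fin d) e => y ij.1 e ij.2)
    (fun ij => hy _ _) ?_
  intro M r hr
  have hpt : ∀ i j, ∃ t < M, r t = fun e => y i e j := fun i j => hr _ (.inr ⟨(i, j), rfl⟩)
  choose pt hpt hpt' using hpt
  let w : Fin l → E → ℝ := fun i e => orc e d k ε l (fun i => y i e) i
  obtain ⟨P, hP⟩ := h (M + l)
    (fun t => if ht : M ≤ t ∧ t < M + l then w ⟨t - M, by omega⟩ else r t) (by
    rintro f (hf | ⟨i, rfl⟩)
    · obtain ⟨t, ht, rfl⟩ := hr f (.inl hf)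
      exact ⟨t, by omega, dif_neg (by omega)⟩
    · refine ⟨M + i, by omega, ?_⟩
      rw [dif_pos ⟨by omega, by omega⟩]
      congr
      simp)
  refine ⟨.call M d k ε l pt P, fun e s hs => ?_⟩
  simp only [Algorithm.run]
  refine hP e _ fun t ht => ?_
  by_cases ht' : M ≤ t
  · have h1 : M ≤ t ∧ t < M + l := ⟨ht', ht⟩
    have hpts : (fun i => WithLp.toLp 2 fun j => s (pt i j)) = fun i => y i e := by
      funext i
      ext j
      simp [hs _ (hpt i j), hpt']
    rw [dif_pos h1, dif_pos h1, hpts]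
  · rw [dif_neg (by omega), dif_neg (by omega)]
    exact hs t (by omega)

end Solves

/-! ### Basic facts on the objectives -/

section Basic

variable {V ι : Type*} [PseudoMetricSpace V] {k z : ℕ}

theorem centerDist_nonneg (p : V) (C : Fin k → V) : 0 ≤ centerDist p C :=
  Real.iInf_nonneg fun _ => dist_nonneg

theorem centerDist_le (p : V) (C : Fin k → V) (j : Fin k) : centerDist p C ≤ dist p (C j) :=
  ciInf_le (Set.finite_range _).bddBelow j

theorem exists_centerDist_eq (hk : 1 ≤ k) (p : V) (C : Fin k → V) :
    ∃ j, centerDist p C = dist p (C j) := by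
  have : Nonempty (Fin k) := ⟨⟨0, hk⟩⟩
  obtain ⟨j, hj⟩ := exists_eq_ciInf_of_finite (f := fun j => dist p (C j))
  exact ⟨j, hj.symm⟩

theorem centerDist_le_add (p q : V) (C : Fin k → V) :
    centerDist p C ≤ centerDist q C + dist p q := by
  rcases Nat.eq_zero_or_pos k with rfl | hk
  · simp [centerDist]
  obtain ⟨j, hj⟩ := exists_centerDist_eq hk q C
  rw [hj, add_comm]
  exact (centerDist_le p C j).trans (dist_triangle _ _ _)

/-- A nonempty family of at most `k` centers can be reindexed by `Fin k`. -/
theorem exists_reindex_centers {κ : Type*} [Fintype κ] [Nonempty κ] (C : κ → V)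
    (hk : Fintype.card κ ≤ k) :
    ∃ C' : Fin k → V, ∀ p : V, (∀ j, centerDist p C' ≤ dist p (C j)) ∧
      ∃ j, centerDist p C' = dist p (C j) := by
  have hk' : 1 ≤ k := Fintype.card_pos.trans_le hk
  obtain ⟨e⟩ : Nonempty (κ ↪ Fin k) := Function.Embedding.nonempty_of_card_le (by simpa using hk)
  refine ⟨fun i => C (Function.invFun e i), fun p => ⟨fun j => ?_, ?_⟩⟩
  · have := centerDist_le p (fun i => C (Function.invFun e i)) (e j)
    rwa [Function.leftInverse_invFun e.injective j] at this
  · obtain ⟨i, hi⟩ := exists_centerDist_eq hk' p fun i => C (Function.invFun e i)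
    exact ⟨_, hi⟩

variable [Fintype ι] {x : ι → V} {w : ι → ℝ} {C : Fin k → V} {h b : ℝ}

theorem bddBelow_robust :
    BddBelow ((fun y : ι → ℝ => cost z x (fun i => w i - y i) C) '' outlierSets w h) := by
  refine ⟨0, ?_⟩
  rintro _ ⟨y, hy, rfl⟩
  exact Finset.sum_nonneg fun i _ =>
    mul_nonneg (sub_nonneg.2 (hy.1 i).2) (pow_nonneg (centerDist_nonneg _ _) _)

/-- Moving `y` along the segment towards `w` until its total is `min h (∑ i, w i)` only lowers the
cost. Hence candidates need not have the exact total that `outlierSets` demands. -/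
theorem robustCost_le {y : ι → ℝ} (hy : ∀ i, 0 ≤ y i ∧ y i ≤ w i)
    (hyh : ∑ i, y i ≤ h) : robustCost z h x w C ≤ cost z x (fun i => w i - y i) C := by
  have hyw : ∑ i, y i ≤ ∑ i, w i := Finset.sum_le_sum fun i _ => (hy i).2
  obtain ⟨t, ht0, ht1, ht⟩ : ∃ t : ℝ, 0 ≤ t ∧ t ≤ 1 ∧
      ∑ i, y i + t * (∑ i, w i - ∑ i, y i) = min h (∑ i, w i) := by
    have hmin : ∑ i, y i ≤ min h (∑ i, w i) := le_min hyh hyw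
    rcases hyw.eq_or_lt with heq | hlt
    · refine ⟨0, le_rfl, zero_le_one, ?_⟩
      rw [zero_mul, add_zero]
      exact le_antisymm hmin (heq ▸ min_le_right _ _)
    · have hpos := sub_pos.2 hlt
      refine ⟨(min h (∑ i, w i) - ∑ i, y i) / (∑ i, w i - ∑ i, y i),
        div_nonneg (sub_nonneg.2 hmin) hpos.le, (div_le_one hpos).2 ?_, ?_⟩
      · linarith [min_le_right h (∑ i, w i)]
      · field_simp
        ring
  have hmem : (fun i => y i + t * (w i - y i)) ∈ outlierSets w h := by
    refine ⟨fun i => ?_, ?_⟩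
    · have h1 := hy i
      constructor
      · have := mul_nonneg ht0 (sub_nonneg.2 h1.2)
        linarith
      · nlinarith [sub_nonneg.2 h1.2]
    · rw [Finset.sum_add_distrib, ← Finset.mul_sum, Finset.sum_sub_distrib, ht]
  refine (csInf_le bddBelow_robust ⟨_, hmem, rfl⟩).trans (Finset.sum_le_sum fun i _ => ?_)
  refine mul_le_mul_of_nonneg_right ?_ (pow_nonneg (centerDist_nonneg _ _) _)
  have := mul_nonneg ht0 (sub_nonneg.2 (hy i).2)
  linarith

/-- The set `outlierSets` must be shown to be nonempty, as the real infimum of the empty set is 0; a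
multiple of `w` is a member. -/
theorem le_robustCost (hw : ∀ i, 0 ≤ w i) (hh : 0 ≤ h)
    (H : ∀ y : ι → ℝ, (∀ i, 0 ≤ y i ∧ y i ≤ w i) → ∑ i, y i ≤ h →
      b ≤ cost z x (fun i => w i - y i) C) : b ≤ robustCost z h x w C := by
  have hW : 0 ≤ ∑ i, w i := Finset.sum_nonneg fun i _ => hw i
  refine le_csInf (Set.Nonempty.image _ ?_) ?_
  · rcases hW.eq_or_lt with h0 | h0
    · exact ⟨fun _ => 0, fun i => ⟨le_rfl, hw i⟩, by simp [← h0, hh]⟩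
    · have hm : 0 ≤ min h (∑ i, w i) := le_min hh hW
      refine ⟨fun i => min h (∑ i, w i) / (∑ i, w i) * w i, fun i => ⟨?_, ?_⟩, ?_⟩
      · exact mul_nonneg (div_nonneg hm hW) (hw i)
      · exact mul_le_of_le_one_left (hw i) ((div_le_one h0).2 (min_le_right _ _))
      · rw [← Finset.mul_sum, div_mul_cancel₀ _ h0.ne']
  · rintro _ ⟨y, hy, rfl⟩
    exact H y hy.1 (hy.2.trans_le (min_le_left _ _))

theorem robustCost_nonneg (hw : ∀ i, 0 ≤ w i) (hh : 0 ≤ h) : 0 ≤ robustCost z h x w C :=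
  le_robustCost hw hh fun _ hy _ => Finset.sum_nonneg fun i _ =>
    mul_nonneg (sub_nonneg.2 (hy i).2) (pow_nonneg (centerDist_nonneg _ _) _)

theorem robustCost_zero (hw : ∀ i, 0 ≤ w i) : robustCost z 0 x w C = cost z x w C := by
  refine le_antisymm ?_ (le_robustCost hw le_rfl fun y hy hy0 => ?_)
  · simpa using robustCost_le (y := fun _ => 0) (h := 0) (x := x) (C := C) (z := z)
      (fun i => ⟨le_rfl, hw i⟩) (by simp)
  · have hz := (Finset.sum_eq_zero_iff_of_nonneg fun i _ => (hy i).1).1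
      (le_antisymm hy0 (Finset.sum_nonneg fun i _ => (hy i).1))
    refine le_of_eq (Finset.sum_congr rfl fun i hi => ?_)
    simp only [hz i hi, sub_zero]

/-- The total cost of points near the centers. -/
theorem sum_near_le {m : ℕ} (hh : 0 ≤ h) (hhm : h ≤ m) {B : ℝ} (hB0 : 0 ≤ B) (W : Finset ι)
    (hW : ∀ i ∈ W, centerDist (x i) C ^ z ≤ B) :
    ∑ i ∈ W, centerDist (x i) C ^ z ≤ robustCost z h x (fun _ => 1) C + m * B := by
  rw [← sub_le_iff_le_add]
  refine le_robustCost (fun _ => zero_le_one) hh fun y hy hyh => ?_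
  have h1 : ∑ i ∈ W, y i * centerDist (x i) C ^ z ≤ m * B := by
    refine (Finset.sum_le_sum fun i hi => mul_le_mul_of_nonneg_left (hW i hi) (hy i).1).trans ?_
    rw [← Finset.sum_mul]
    refine mul_le_mul_of_nonneg_right ?_ hB0
    exact (Finset.sum_le_sum_of_subset_of_nonneg (Finset.subset_univ _)
      fun i _ _ => (hy i).1).trans (hyh.trans hhm)
  have h2 : ∑ i ∈ W, (1 - y i) * centerDist (x i) C ^ z ≤ cost z x (fun i => 1 - y i) C :=
    Finset.sum_le_sum_of_subset_of_nonneg (Finset.subset_univ _)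
      fun i _ _ => mul_nonneg (sub_nonneg.2 (hy i).2) (pow_nonneg (centerDist_nonneg _ _) _)
  simp only [sub_mul, one_mul, Finset.sum_sub_distrib] at h2
  linarith

/-- The number of points far from the centers. -/
theorem card_far_mul_le {m : ℕ} (hh : 0 ≤ h) (hhm : h ≤ m) {B : ℝ} (hB0 : 0 ≤ B)
    (W : Finset ι) (hW : ∀ i ∈ W, B ≤ centerDist (x i) C ^ z) :
    W.card * B ≤ robustCost z h x (fun _ => 1) C + m * B := by
  rw [← sub_le_iff_le_add]
  refine le_robustCost (fun _ => zero_le_one) hh fun y hy hyh => ?_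
  have h2 : ∑ i ∈ W, (1 - y i) * B ≤ cost z x (fun i => 1 - y i) C := by
    refine (Finset.sum_le_sum fun i hi => ?_).trans
      (Finset.sum_le_sum_of_subset_of_nonneg (Finset.subset_univ W)
      fun i _ _ => mul_nonneg (sub_nonneg.2 (hy i).2) (pow_nonneg (centerDist_nonneg _ _) _))
    exact mul_le_mul_of_nonneg_left (hW i hi) (sub_nonneg.2 (hy i).2)
  rw [← Finset.sum_mul, Finset.sum_sub_distrib, Finset.sum_const, nsmul_eq_mul, mul_one] at h2
  have h3 : ∑ i ∈ W, y i ≤ m :=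
    (Finset.sum_le_sum_of_subset_of_nonneg (Finset.subset_univ _)
      fun i _ _ => (hy i).1).trans (hyh.trans hhm)
  have h4 := mul_le_mul_of_nonneg_right h3 hB0
  linarith

end Basic

/-! ### Comparing robust costs of two weighted sets with equal masses on the pieces of a partition -/

section Transfer

/-- Since both families have the same mass, the weights `α i * β j` on pairs form, up to that mass
as a factor, a transport plan; the pointwise inequality is averaged over it. -/
theorem sum_mul_le_of_sum_eq {ι : Type*} (s : Finset ι) {α β g : ι → ℝ} {t b : ℝ}
    (hα : ∀ i ∈ s, 0 ≤ α i) (hβ : ∀ i ∈ s, 0 ≤ β i) (hsum : ∑ i ∈ s, α i = ∑ i ∈ s, β i)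
    (hg : ∀ i ∈ s, ∀ j ∈ s, g i ≤ t * g j + b) :
    ∑ i ∈ s, α i * g i ≤ t * ∑ i ∈ s, β i * g i + b * ∑ i ∈ s, β i := by
  rcases (Finset.sum_nonneg hβ).eq_or_lt with h0 | h0
  · have h1 := (Finset.sum_eq_zero_iff_of_nonneg hβ).1 h0.symm
    have h2 := (Finset.sum_eq_zero_iff_of_nonneg hα).1 (hsum.trans h0.symm)
    rw [Finset.sum_eq_zero fun i hi => by rw [h2 i hi, zero_mul],
      Finset.sum_eq_zero (f := fun i => β i * g i) fun i hi => by rw [h1 i hi, zero_mul], ← h0]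
    simp
  · refine le_of_mul_le_mul_left ?_ h0
    calc (∑ j ∈ s, β j) * ∑ i ∈ s, α i * g i
        = ∑ i ∈ s, ∑ j ∈ s, β j * α i * g i := by
          rw [Finset.mul_sum]
          refine Finset.sum_congr rfl fun i _ => ?_
          rw [Finset.sum_mul]
          exact Finset.sum_congr rfl fun j _ => by ring
      _ ≤ ∑ i ∈ s, ∑ j ∈ s, α i * (t * (β j * g j) + b * β j) := by
          refine Finset.sum_le_sum fun i hi => Finset.sum_le_sum fun j hj => ?_
          have := mul_le_mul_of_nonneg_left (hg i hi j hj) (mul_nonneg (hα i hi) (hβ j hj))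
          linarith
      _ = (∑ i ∈ s, α i) * (t * ∑ i ∈ s, β i * g i + b * ∑ i ∈ s, β i) := by
          simp only [← Finset.mul_sum, Finset.sum_add_distrib, ← Finset.sum_mul]
      _ = _ := by rw [hsum]

variable {V ι κ : Type*} [PseudoMetricSpace V] [Fintype ι] [Fintype κ] [DecidableEq κ]
  {k z : ℕ} {x : ι → V} {C : Fin k → V} {h b t D : ℝ} {u v : ι → ℝ}

/-- Removing from every piece of `v` proportionally the mass that is removed from this piece
of `u`: the pieces `a ∈ N` are near the centers, and there `u` and `v` have similar costs; on the
other pieces the distance to the centers is almost constant. -/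
theorem robustCost_le_of_mass_eq (hu : ∀ i, 0 ≤ u i) (hv : ∀ i, 0 ≤ v i) (hh : 0 ≤ h)
    (ht : 1 ≤ t) (hb : 0 ≤ b) (p : ι → κ) (N : Finset κ)
    (hmass : ∀ a, ∑ i with p i = a, u i = ∑ i with p i = a, v i)
    (hfar : ∀ i j, p i = p j → p i ∉ N →
      centerDist (x i) C ^ z ≤ t * centerDist (x j) C ^ z)
    (hnear : ∀ i j, p i = p j → p i ∈ N →
      centerDist (x i) C ^ z ≤ centerDist (x j) C ^ z + b)
    (hcost : ∑ i with p i ∈ N, v i * centerDist (x i) C ^ z ≤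
      ∑ i with p i ∈ N, u i * centerDist (x i) C ^ z + D) :
    robustCost z h x v C ≤ t * robustCost z h x u C + (b * h + D) := by
  have ht0 : 0 < t := by linarith
  suffices H : (robustCost z h x v C - (b * h + D)) / t ≤ robustCost z h x u C by
    rw [div_le_iff₀ ht0] at H
    linarith
  refine le_robustCost hu hh fun y hy hyh => ?_
  rw [div_le_iff₀ ht0, sub_le_iff_le_add]
  set g : ι → ℝ := fun i => centerDist (x i) C ^ z with hgdef
  have hg : ∀ i, 0 ≤ g i := fun i => pow_nonneg (centerDist_nonneg _ _) _
  set U : κ → ℝ := fun a => ∑ i with p i = a, u i with hU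
  set Y : κ → ℝ := fun a => ∑ i with p i = a, y i with hY
  have hU0 : ∀ a, 0 ≤ U a := fun a => Finset.sum_nonneg fun i _ => hu i
  have hY0 : ∀ a, 0 ≤ Y a := fun a => Finset.sum_nonneg fun i _ => (hy i).1
  have hYU : ∀ a, Y a ≤ U a := fun a => Finset.sum_le_sum fun i _ => (hy i).2
  -- If `U (p i) = 0`, the quotient is 0 by convention, which is the right value since then `Y (p i)
  -- = 0` as well.
  set y' : ι → ℝ := fun i => v i * (Y (p i) / U (p i)) with hy'
  have hy'v : ∀ i, 0 ≤ y' i ∧ y' i ≤ v i := fun i =>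
    ⟨mul_nonneg (hv i) (div_nonneg (hY0 _) (hU0 _)),
      mul_le_of_le_one_right (hv i) (div_le_one_of_le₀ (hYU _) (hU0 _))⟩
  have hY' : ∀ a, ∑ i with p i = a, y' i = Y a := by
    intro a
    have h1 : ∑ i with p i = a, y' i = ∑ i with p i = a, v i * (Y a / U a) :=
      Finset.sum_congr rfl fun i hi => by
        simp only [hy', (Finset.mem_filter.1 hi).2]
    rw [h1, ← Finset.sum_mul, ← hmass a]
    change U a * (Y a / U a) = Y a
    rcases eq_or_ne (U a) 0 with h0 | h0
    · have : Y a = 0 := le_antisymm (h0 ▸ hYU a) (hY0 a)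
      rw [this, zero_div, mul_zero]
    · field_simp
  have hsumY : ∑ i, y' i = ∑ i, y i := by
    rw [← Finset.sum_fiberwise Finset.univ p y', ← Finset.sum_fiberwise Finset.univ p y]
    exact Finset.sum_congr rfl fun a _ => hY' a
  refine (robustCost_le hy'v (hsumY.trans_le hyh)).trans ?_
  -- On near pieces the costs of `u` and `v` are comparable only in total, so their difference is
  -- carried along until the sum over all pieces is formed.
  have key : ∀ a, ∑ i with p i = a, (v i - y' i) * g i ≤
      t * ∑ i with p i = a, (u i - y i) * g i + b * Y a +
        if a ∈ N then ∑ i with p i = a, v i * g i - ∑ i with p i = a, u i * g i else 0 := by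
    intro a
    by_cases ha : a ∈ N
    · rw [if_pos ha]
      have h1 := sum_mul_le_of_sum_eq (Finset.univ.filter fun i => p i = a) (α := y) (β := y')
        (g := g) (t := 1) (b := b) (fun i _ => (hy i).1) (fun i _ => (hy'v i).1) (hY' a).symm
        (fun i hi j hj => by
          have hi := (Finset.mem_filter.1 hi).2
          have hj := (Finset.mem_filter.1 hj).2
          rw [one_mul]
          exact hnear i j (hi.trans hj.symm) (hi ▸ ha))
      rw [hY' a] at h1
      have h2 : 0 ≤ ∑ i with p i = a, (u i - y i) * g i :=
        Finset.sum_nonneg fun i _ => mul_nonneg (sub_nonneg.2 (hy i).2) (hg i)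
      have h3 := le_mul_of_one_le_left h2 ht
      simp only [sub_mul, Finset.sum_sub_distrib] at h2 h3 ⊢
      linarith
    · rw [if_neg ha, add_zero]
      have h1 := sum_mul_le_of_sum_eq (Finset.univ.filter fun i => p i = a)
        (α := fun i => v i - y' i) (β := fun i => u i - y i) (g := g) (t := t) (b := 0)
        (fun i _ => sub_nonneg.2 (hy'v i).2) (fun i _ => sub_nonneg.2 (hy i).2)
        (by rw [Finset.sum_sub_distrib, Finset.sum_sub_distrib, hY' a, hmass a])
        (fun i hi j hj => by
          have hi := (Finset.mem_filter.1 hi).2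
          have hj := (Finset.mem_filter.1 hj).2
          rw [add_zero]
          exact hfar i j (hi.trans hj.symm) (hi ▸ ha))
      have := mul_nonneg hb (hY0 a)
      linarith
  have hfib : ∀ f : ι → ℝ, ∑ a ∈ N, ∑ i with p i = a, f i = ∑ i with p i ∈ N, f i := by
    intro f
    rw [← Finset.sum_fiberwise_of_maps_to (s := Finset.univ.filter fun i => p i ∈ N) (t := N)
      (g := p) (fun i hi => (Finset.mem_filter.1 hi).2)]
    refine Finset.sum_congr rfl fun a ha => ?_
    rw [Finset.filter_filter]
    refine Finset.sum_congr (Finset.filter_congr fun i _ => ?_) fun _ _ => rfl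
    constructor
    · exact fun h => ⟨h ▸ ha, h⟩
    · exact fun h => h.2
  have htot := Finset.sum_le_sum fun a (_ : a ∈ Finset.univ) => key a
  rw [Finset.sum_add_distrib, Finset.sum_add_distrib, ← Finset.mul_sum, ← Finset.mul_sum,
    Finset.sum_fiberwise, Finset.sum_fiberwise, Finset.sum_fiberwise, ← Finset.sum_filter,
    Finset.sum_sub_distrib, Finset.filter_mem_eq_inter, Finset.univ_inter, hfib, hfib] at htot
  have := mul_le_mul_of_nonneg_left hyh hb
  simp only [cost]
  linarith

end Transfer

/-! ### Elementary inequalities -/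

/-- Combines `1 + t ≤ exp t` with `exp s ≤ 1 / (1 - s)` for `s = z * t ≤ e / 2 ≤ 1 / 2`. -/
theorem one_add_pow_le {z : ℕ} {t e : ℝ} (hz : 1 ≤ z) (ht : 0 ≤ t) (he : e ≤ 1)
    (hte : 2 * z * t ≤ e) : (1 + t) ^ z ≤ 1 + e := by
  have hz' : (1 : ℝ) ≤ z := by exact_mod_cast hz
  have h1 : (1 + t) ^ z ≤ Real.exp (z * t) := by
    rw [Real.exp_nat_mul]
    exact pow_le_pow_left₀ (by linarith) (by linarith [Real.add_one_le_exp t]) _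
  have h0 : 0 ≤ (z : ℝ) * t := by positivity
  have h2 : Real.exp (z * t) ≤ 1 / (1 - z * t) := by
    rw [le_div_iff₀ (by nlinarith)]
    have := Real.add_one_le_exp (-(z * t))
    have h3 : Real.exp (z * t) * Real.exp (-(z * t)) = 1 := by
      rw [← Real.exp_add]; simp
    nlinarith [Real.exp_pos (z * t)]
  refine h1.trans (h2.trans ?_)
  rw [div_le_iff₀ (by nlinarith)]
  nlinarith

theorem add_pow_le_of_le_mul {z : ℕ} {D δ e : ℝ} (hz : 1 ≤ z) (hD : 0 ≤ D) (hδ : 0 ≤ δ)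
    (he : e ≤ 1) (h : 2 * z * δ ≤ e * D) : (D + δ) ^ z ≤ (1 + e) * D ^ z := by
  rcases hD.eq_or_lt with rfl | hD
  · have hz' : (1 : ℝ) ≤ z := by exact_mod_cast hz
    have : δ = 0 := by nlinarith
    subst this
    simp [show z ≠ 0 by omega]
  · have h1 : D + δ = D * (1 + δ / D) := by field_simp
    rw [h1, mul_pow, mul_comm]
    refine mul_le_mul_of_nonneg_right (one_add_pow_le hz (by positivity) he ?_) (by positivity)
    rw [← mul_div_assoc, div_le_iff₀ hD]
    exact h

theorem pow_sub_pow_le_mul {z : ℕ} {a b : ℝ} (ha : 0 ≤ a) (hab : a ≤ b) :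
    b ^ (z + 1) - a ^ (z + 1) ≤ (z + 1) * (b - a) * b ^ z := by
  induction z with
  | zero => simp
  | succ z ih =>
    have h1 : a ^ (z + 1) ≤ b ^ (z + 1) := pow_le_pow_left₀ ha hab _
    have h2 := mul_le_mul_of_nonneg_right h1 (sub_nonneg.2 hab)
    have h3 := mul_le_mul_of_nonneg_left ih (ha.trans hab)
    push_cast
    calc b ^ (z + 1 + 1) - a ^ (z + 1 + 1)
        = b * (b ^ (z + 1) - a ^ (z + 1)) + a ^ (z + 1) * (b - a) := by ring
      _ ≤ b * ((z + 1) * (b - a) * b ^ z) + b ^ (z + 1) * (b - a) := add_le_add h3 h2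
      _ = _ := by ring

/-- The increments of `D ↦ D ^ z` on an interval of length `δ` below `T + δ`. -/
theorem pow_le_pow_add_of_le {z : ℕ} {D δ T e a : ℝ} (hz : 1 ≤ z) (hD : 0 ≤ D) (hδ : 0 ≤ δ)
    (hT : D ≤ T) (he : e ≤ 1) (h : 2 * z * δ ≤ e * T) (ha0 : 0 ≤ a)
    (ha : a ≤ D + δ) : a ^ z ≤ D ^ z + e * T ^ z := by
  obtain ⟨z, rfl⟩ : ∃ y, z = y + 1 := ⟨z - 1, by omega⟩
  have hT0 : 0 ≤ T := hD.trans hT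
  have h1 := pow_sub_pow_le_mul (z := z) hD (le_add_of_nonneg_right hδ : D ≤ D + δ)
  have h2 : a ^ (z + 1) ≤ (D + δ) ^ (z + 1) := pow_le_pow_left₀ ha0 ha _
  have h3 : (D + δ) ^ z ≤ (T + δ) ^ z := pow_le_pow_left₀ (by positivity) (by linarith) _
  have h5 : (T + δ) ^ z ≤ 2 * T ^ z := by
    rcases Nat.eq_zero_or_pos z with rfl | hz0
    · norm_num
    · refine (add_pow_le_of_le_mul (e := 1) hz0 hT0 hδ le_rfl ?_).trans (by linarith)
      push_cast at h
      nlinarith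
  have h6 : ((z : ℝ) + 1) * (D + δ - D) * (D + δ) ^ z ≤ (z + 1) * δ * (2 * T ^ z) := by
    rw [add_sub_cancel_left]
    exact mul_le_mul_of_nonneg_left (h3.trans h5) (by positivity)
  have h7 : ((z : ℝ) + 1) * δ * (2 * T ^ z) ≤ e * T ^ (z + 1) := by
    push_cast at h
    have := mul_le_mul_of_nonneg_right h (pow_nonneg hT0 z)
    rw [pow_succ]
    linarith
  linarith

theorem add_add_pow_le (z : ℕ) {a b c : ℝ} (ha : 0 ≤ a) (hb : 0 ≤ b) (hc : 0 ≤ c) :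
    (a + b + c) ^ z ≤ 3 ^ z * (a ^ z + b ^ z + c ^ z) := by
  have h : a + b + c ≤ 3 * max (max a b) c := by
    have h1 := le_max_left (max a b) c
    have h2 := le_max_right (max a b) c
    linarith [le_max_left a b, le_max_right a b]
  refine (pow_le_pow_left₀ (by positivity) h z).trans ?_
  rw [mul_pow]
  refine mul_le_mul_of_nonneg_left ?_ (by positivity)
  have ha' := pow_nonneg ha z
  have hb' := pow_nonneg hb z
  have hc' := pow_nonneg hc z
  rcases max_choice (max a b) c with h | h <;> rw [h]
  · rcases max_choice a b with h | h <;> rw [h] <;> linarith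
  · linarith

/-! ### Sparse partitions of finite metric spaces -/

section Sparse

variable {V ι : Type*} [PseudoMetricSpace V] [DecidableEq ι]

/-- Ball growing: at least half of the points of `U` can be partitioned into pieces of small
radius that are more than `τ` apart. -/
theorem exists_separated_pieces (c : ι → V) {τ : ℝ} (hτ : 0 ≤ τ) (p : ℕ) (U : Finset ι)
    (hU : U.card < 2 ^ p) : ∃ (U' : Finset ι) (π : ι → ι), U' ⊆ U ∧ U.card ≤ 2 * U'.card ∧
      (∀ i ∈ U', dist (c i) (c (π i)) ≤ p * τ) ∧
      ∀ i ∈ U', ∀ j ∈ U', dist (c i) (c j) ≤ τ → π i = π j := by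
  classical
  induction U using Finset.strongInduction with
  | H U ih =>
  rcases U.eq_empty_or_nonempty with rfl | ⟨v, hv⟩
  · exact ⟨∅, id, by simp⟩
  let B : ℕ → Finset ι := fun t => U.filter fun i => dist (c i) (c v) ≤ t * τ
  have hvB : ∀ t, v ∈ B t := fun t => by simp only [B, Finset.mem_filter, dist_self]
                                         exact ⟨hv, by positivity⟩
  -- If each of `p` successive balls had more than twice the size of the one before, the last would
  -- contain at least `2 ^ p` points of `U`.
  obtain ⟨t, htp, ht⟩ : ∃ t < p, (B (t + 1)).card ≤ 2 * (B t).card := by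
    by_contra! hcon
    have : ∀ t ≤ p, 2 ^ t ≤ (B t).card := by
      intro t
      induction t with
      | zero => exact fun _ => Finset.card_pos.2 ⟨v, hvB 0⟩
      | succ t iht =>
        intro ht
        have h1 := hcon t ht
        have h2 := iht (by omega)
        rw [pow_succ]
        omega
    exact absurd ((this p le_rfl).trans (Finset.card_le_card (Finset.filter_subset _ _)))
      (by simpa using hU)
  have hss : U \ B (t + 1) ⊂ U :=
    Finset.ssubset_iff_subset_ne.2 ⟨Finset.sdiff_subset, fun h => by
      have := h ▸ hv
      exact (Finset.mem_sdiff.1 this).2 (hvB _)⟩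
  obtain ⟨U', π, hU', hcard, hrad, hsep⟩ :=
    ih _ hss ((Finset.card_le_card Finset.sdiff_subset).trans_lt hU)
  have hBsub : B t ⊆ B (t + 1) := by
    intro i hi
    simp only [B, Finset.mem_filter] at hi ⊢
    refine ⟨hi.1, hi.2.trans (mul_le_mul_of_nonneg_right ?_ hτ)⟩
    push_cast
    linarith
  have hdisj : Disjoint (B t) U' := by
    rw [Finset.disjoint_left]
    intro i hi hi'
    exact (Finset.mem_sdiff.1 (hU' hi')).2 (hBsub hi)
  have hcross : ∀ i ∈ B t, ∀ j ∈ U', ¬ dist (c i) (c j) ≤ τ := by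
    intro i hi j hj hij
    have hj' := Finset.mem_sdiff.1 (hU' hj)
    refine hj'.2 ?_
    simp only [B, Finset.mem_filter] at hi ⊢
    refine ⟨hj'.1, ?_⟩
    have := dist_triangle (c j) (c i) (c v)
    rw [dist_comm (c j) (c i)] at this
    push_cast
    linarith [hi.2]
  -- The shell between the two balls is dropped. It has at most as many points as `B t`, and it
  -- separates `B t` from everything that remains.
  refine ⟨B t ∪ U', fun i => if i ∈ B t then v else π i, ?_, ?_, ?_, ?_⟩
  · exact Finset.union_subset (Finset.filter_subset _ _) (hU'.trans Finset.sdiff_subset)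
  · rw [Finset.card_union_of_disjoint hdisj]
    have := Finset.card_sdiff_add_card_eq_card (s := B (t + 1)) (t := U) (Finset.filter_subset _ _)
    omega
  · intro i hi
    by_cases hiB : i ∈ B t
    · simp only [hiB, if_true]
      refine (Finset.mem_filter.1 hiB).2.trans (mul_le_mul_of_nonneg_right ?_ hτ)
      exact_mod_cast htp.le
    · simp only [hiB, if_false]
      exact hrad i ((Finset.mem_union.1 hi).resolve_left hiB)
  · intro i hi j hj hij
    by_cases hiB : i ∈ B t <;> by_cases hjB : j ∈ B t
    · simp [hiB, hjB]
    · exact absurd hij (hcross i hiB j ((Finset.mem_union.1 hj).resolve_left hjB))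
    · rw [dist_comm] at hij
      exact absurd hij (hcross j hjB i ((Finset.mem_union.1 hi).resolve_left hiB))
    · simp only [hiB, hjB, if_false]
      exact hsep i ((Finset.mem_union.1 hi).resolve_left hiB) j
        ((Finset.mem_union.1 hj).resolve_left hjB) hij

/-- Fewer than `2 ^ p` points can be partitioned into pieces of radius `p τ` with `p` colors, so
that pieces of the same color are more than `τ` apart. -/
theorem exists_sparse_partition [Fintype ι] (c : ι → V) {τ : ℝ} (hτ : 0 ≤ τ) (p : ℕ)
    (hp : Fintype.card ι < 2 ^ p) : ∃ (π : ι → ι) (col : ι → Fin p),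
      (∀ i, dist (c i) (c (π i)) ≤ p * τ) ∧
      ∀ i j, col i = col j → dist (c i) (c j) ≤ τ → π i = π j := by
  -- Each color takes at least half of the points that are left, so `r` colors suffice for fewer
  -- than `2 ^ r` points. The radius is bounded by the final `p` throughout.
  suffices H : ∀ (r : ℕ), r ≤ p → ∀ U : Finset ι, U.card < 2 ^ r →
      ∃ (π : ι → ι) (col : ι → ℕ), (∀ i ∈ U, col i < r ∧ dist (c i) (c (π i)) ≤ p * τ) ∧
        ∀ i ∈ U, ∀ j ∈ U, col i = col j → dist (c i) (c j) ≤ τ → π i = π j by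
    obtain ⟨π, col, h1, h2⟩ := H p le_rfl Finset.univ hp
    exact ⟨π, fun i => ⟨col i, (h1 i (Finset.mem_univ _)).1⟩,
      fun i => (h1 i (Finset.mem_univ _)).2,
      fun i j hij => h2 i (Finset.mem_univ _) j (Finset.mem_univ _) (by simpa using hij)⟩
  intro r
  induction r with
  | zero =>
    intro _ U hU
    have : U = ∅ := by simpa using hU
    exact ⟨id, fun _ => 0, by simp [this]⟩
  | succ r ih =>
    intro hr U hU
    obtain ⟨U', π', hU', hcard, hrad, hsep⟩ := exists_separated_pieces c hτ (r + 1) U hU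
    obtain ⟨π, col, h1, h2⟩ := ih (by omega) (U \ U') (by
      rw [Finset.card_sdiff_of_subset hU']
      rw [pow_succ] at hU
      omega)
    refine ⟨fun i => if i ∈ U' then π' i else π i, fun i => if i ∈ U' then r else col i, ?_, ?_⟩
    · intro i hi
      by_cases hi' : i ∈ U'
      · simp only [hi', if_true]
        refine ⟨by omega, (hrad i hi').trans (mul_le_mul_of_nonneg_right ?_ hτ)⟩
        exact_mod_cast hr
      · simp only [hi', if_false]
        have := h1 i (Finset.mem_sdiff.2 ⟨hi, hi'⟩)
        exact ⟨by omega, this.2⟩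
    · intro i hi j hj hc hij
      by_cases hi' : i ∈ U' <;> by_cases hj' : j ∈ U' <;> simp only [hi', hj', if_true, if_false]
        at hc ⊢
      · exact hsep i hi' j hj' hij
      · exact absurd hc.symm (h1 j (Finset.mem_sdiff.2 ⟨hj, hj'⟩)).1.ne
      · exact absurd hc (h1 i (Finset.mem_sdiff.2 ⟨hi, hi'⟩)).1.ne
      · exact h2 i (Finset.mem_sdiff.2 ⟨hi, hi'⟩) j (Finset.mem_sdiff.2 ⟨hj, hj'⟩) hc hij

end Sparse

/-! ### Discrete solutions -/

section Discrete

variable {V ι : Type*} [PseudoMetricSpace V] [Fintype ι] [DecidableEq ι] {k z m : ℕ}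

/-- The cost of the points outside `O`, where `i` is assigned to the center `x (s (q i))`. -/
def assignCost (z : ℕ) (x : ι → V) (b : (Fin k → ι) × (ι → Fin k) × Finset ι) : ℝ :=
  ∑ i ∈ b.2.2ᶜ, dist (x i) (x (b.1 (b.2.1 i))) ^ z

/-- `b` is an optimal solution with at most `m` outliers and centers in the dataset. -/
def IsOptimal (z m : ℕ) (x : ι → V) (b : (Fin k → ι) × (ι → Fin k) × Finset ι) : Prop :=
  b.2.2.card ≤ m ∧ ∀ b' : (Fin k → ι) × (ι → Fin k) × Finset ι,
    b'.2.2.card ≤ m → assignCost z x b ≤ assignCost z x b'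

theorem exists_isOptimal [Nonempty ι] (hk : 1 ≤ k) (z m : ℕ) (x : ι → V) :
    ∃ b : (Fin k → ι) × (ι → Fin k) × Finset ι, IsOptimal z m x b := by
  classical
  have : Nonempty (Fin k) := ⟨⟨0, hk⟩⟩
  obtain ⟨b, hb, hb'⟩ := (Finset.univ.filter fun b : (Fin k → ι) × (ι → Fin k) × Finset ι =>
    b.2.2.card ≤ m).exists_min_image (assignCost z x)
      ⟨⟨fun _ => Classical.arbitrary _, fun _ => Classical.arbitrary _, ∅⟩, by simp⟩
  exact ⟨b, (Finset.mem_filter.1 hb).2, fun b' h => hb' b' (by simpa using h)⟩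

theorem assignCost_nonneg (x : ι → V) (b : (Fin k → ι) × (ι → Fin k) × Finset ι) :
    0 ≤ assignCost z x b :=
  Finset.sum_nonneg fun _ _ => pow_nonneg dist_nonneg _

/-- Fractional removal of mass `m` is not better than the removal of some `m` points. -/
theorem exists_sum_compl_le (g : ι → ℝ) (hg : ∀ i, 0 ≤ g i) (m : ℕ) (y : ι → ℝ)
    (hy : ∀ i, 0 ≤ y i ∧ y i ≤ 1) (hym : ∑ i, y i ≤ m) :
    ∃ O : Finset ι, O.card ≤ m ∧ ∑ i ∈ Oᶜ, g i ≤ ∑ i, (1 - y i) * g i := by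
  classical
  suffices H : ∀ r ≤ m, r ≤ Fintype.card ι → ∃ O : Finset ι, O.card = r ∧
      ∀ i ∈ O, ∀ j ∉ O, g j ≤ g i by
    rcases le_total (Fintype.card ι) m with hm | hm
    · refine ⟨Finset.univ, hm, ?_⟩
      simpa using Finset.sum_nonneg fun i (_ : i ∈ Finset.univ) =>
        mul_nonneg (sub_nonneg.2 (hy i).2) (hg i)
    · obtain ⟨O, hO, hO'⟩ := H m le_rfl hm
      refine ⟨O, hO.le, ?_⟩
      -- With a threshold `t` between the values off `O` and on `O`, a unit of removed mass saves at
      -- most `t` off `O`, and a unit left in place on `O` costs at least `t`.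
      obtain ⟨t, ht0, ht1, ht2⟩ : ∃ t : ℝ, 0 ≤ t ∧ (∀ i ∈ O, t ≤ g i) ∧ ∀ j ∉ O, g j ≤ t := by
        rcases O.eq_empty_or_nonempty with rfl | hne
        · exact ⟨∑ i, g i, Finset.sum_nonneg fun i _ => hg i, by simp, fun j _ =>
            Finset.single_le_sum (fun i _ => hg i) (Finset.mem_univ j)⟩
        · obtain ⟨i₀, hi₀, h⟩ := O.exists_min_image g hne
          exact ⟨g i₀, hg _, h, hO' i₀ hi₀⟩
      have h1 : ∀ i ∈ O, (1 - y i) * t ≤ (1 - y i) * g i := fun i hi =>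
        mul_le_mul_of_nonneg_left (ht1 i hi) (sub_nonneg.2 (hy i).2)
      have h2 : ∀ i ∈ Oᶜ, g i - y i * t ≤ (1 - y i) * g i := fun i hi => by
        have := mul_le_mul_of_nonneg_left (ht2 i (Finset.mem_compl.1 hi)) (hy i).1
        linarith
      have h3 := Finset.sum_le_sum h1
      have h4 := Finset.sum_le_sum h2
      rw [← Finset.sum_add_sum_compl O]
      rw [← Finset.sum_mul, Finset.sum_sub_distrib] at h3
      rw [Finset.sum_sub_distrib, ← Finset.sum_mul] at h4
      rw [← Finset.sum_add_sum_compl O] at hym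
      simp only [Finset.sum_const, nsmul_eq_mul, mul_one, hO] at h3
      have := mul_le_mul_of_nonneg_right hym ht0
      linarith
  intro r
  induction r with
  | zero => exact fun _ _ => ⟨∅, by simp⟩
  | succ r ih =>
    intro hr hr'
    obtain ⟨O, hO, hO'⟩ := ih (by omega) (by omega)
    have hne : Oᶜ.Nonempty := by
      rw [← Finset.card_pos, Finset.card_compl]
      omega
    obtain ⟨i₀, hi₀, h⟩ := Oᶜ.exists_max_image g hne
    rw [Finset.mem_compl] at hi₀
    refine ⟨insert i₀ O, by rw [Finset.card_insert_of_notMem hi₀, hO], ?_⟩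
    intro i hi j hj
    rw [Finset.mem_insert, not_or] at hj
    rcases Finset.mem_insert.1 hi with rfl | hi
    · exact h j (Finset.mem_compl.2 hj.2)
    · exact hO' i hi j hj.2

/-- Outliers are made whole by `exists_sum_compl_le`. Each center moves to its nearest data point,
which is no farther from it than any point it serves, so distances at most double. -/
theorem IsOptimal.le_robustCost [Nonempty ι] {x : ι → V}
    {b : (Fin k → ι) × (ι → Fin k) × Finset ι} (hb : IsOptimal z m x b) (hk : 1 ≤ k)
    (C : Fin k → V) {h : ℝ} (hh : 0 ≤ h) (hm : h ≤ m) :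
    assignCost z x b ≤ 2 ^ z * robustCost z h x (fun _ => 1) C := by
  suffices H : assignCost z x b / 2 ^ z ≤ robustCost z h x (fun _ => 1) C by
    rwa [div_le_iff₀' (by positivity)] at H
  refine RobustCoreset.le_robustCost (fun _ => zero_le_one) hh fun y hy hyh => ?_
  obtain ⟨O, hO, hO'⟩ := exists_sum_compl_le (fun i => centerDist (x i) C ^ z)
    (fun i => pow_nonneg (centerDist_nonneg _ _) _) m y hy (hyh.trans hm)
  refine le_trans ?_ hO'
  choose q hq using fun i => exists_centerDist_eq hk (x i) C
  choose s hs using fun j => Finite.exists_min fun i => dist (x i) (C j)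
  rw [div_le_iff₀' (by positivity)]
  refine (hb.2 (s, q, O) hO).trans ?_
  rw [assignCost, Finset.mul_sum]
  refine Finset.sum_le_sum fun i _ => ?_
  rw [← mul_pow]
  refine pow_le_pow_left₀ dist_nonneg ?_ z
  have h1 := dist_triangle_right (x i) (x (s (q i))) (C (q i))
  have h2 := hs (q i) i
  rw [hq i]
  linarith

/-- Few points outside `O` have a large connection cost. -/
theorem card_filter_lt_le (x : ι → V) (b : (Fin k → ι) × (ι → Fin k) × Finset ι) {ρ : ℝ}
    (hρ : 0 < ρ) :
    ((b.2.2ᶜ.filter fun i => ρ * assignCost z x b < dist (x i) (x (b.1 (b.2.1 i))) ^ z).card : ℝ)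
      ≤ ρ⁻¹ := by
  set W := b.2.2ᶜ.filter fun i => ρ * assignCost z x b < dist (x i) (x (b.1 (b.2.1 i))) ^ z
  have h1 : ∑ i ∈ W, dist (x i) (x (b.1 (b.2.1 i))) ^ z ≤ assignCost z x b :=
    Finset.sum_le_sum_of_subset_of_nonneg (Finset.filter_subset _ _)
      fun _ _ _ => pow_nonneg dist_nonneg _
  rcases W.eq_empty_or_nonempty with h | h
  · rw [h]
    simpa using hρ.le
  · have h2 : ∑ i ∈ W, ρ * assignCost z x b < ∑ i ∈ W, dist (x i) (x (b.1 (b.2.1 i))) ^ z :=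
      Finset.sum_lt_sum_of_nonempty h fun i hi => (Finset.mem_filter.1 hi).2
    rw [Finset.sum_const, nsmul_eq_mul] at h2
    have h3 := assignCost_nonneg (z := z) x b
    rw [le_inv_comm₀ (by exact_mod_cast Finset.card_pos.2 h) hρ]
    by_contra! hcon
    have hc : (0 : ℝ) < W.card := by exact_mod_cast Finset.card_pos.2 h
    rw [inv_lt_iff_one_lt_mul₀ hc] at hcon
    nlinarith

end Discrete

/-! ### Datasets with large clusters of small diameter -/

section Dense

variable {V ι κ : Type*} [PseudoMetricSpace V] [DecidableEq κ]
  {k z : ℕ} {x : ι → V} {C : Fin k → V} {h η U a b s₀ : ℝ} {w : ι → ℝ} {G : Finset ι}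

/-- The cost of a small mass in a family of large clusters. -/
theorem sum_mul_le_of_large_clusters (q : ι → κ) {g y : ι → ℝ} (hg : ∀ i, 0 ≤ g i)
    (hy : ∀ i, 0 ≤ y i) (hyh : ∑ i ∈ G, y i ≤ h) (hs₀ : 0 < s₀) (ha : 0 ≤ a) (hb : 0 ≤ b)
    (hlarge : ∀ i ∈ G, s₀ ≤ ((G.filter fun j => q j = q i).card : ℝ))
    (hgg : ∀ i ∈ G, ∀ j ∈ G, q j = q i → g i ≤ a * g j + b) :
    ∑ i ∈ G, y i * g i ≤ h * (a / s₀) * ∑ i ∈ G, g i + h * b := by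
  have hA : 0 ≤ ∑ i ∈ G, g i := Finset.sum_nonneg fun i _ => hg i
  -- A point is compared with the average of its cluster, which has at least `s₀` points.
  have key : ∀ i ∈ G, g i ≤ a / s₀ * ∑ i ∈ G, g i + b := by
    intro i hi
    have hn := hlarge i hi
    set n : ℝ := ((G.filter fun j => q j = q i).card : ℝ)
    have hn0 : 0 < n := hs₀.trans_le hn
    have h1 : ∑ j ∈ G.filter (fun j => q j = q i), g i ≤
        ∑ j ∈ G.filter (fun j => q j = q i), (a * g j + b) :=
      Finset.sum_le_sum fun j hj => hgg i hi j (Finset.mem_filter.1 hj).1 (Finset.mem_filter.1 hj).2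
    rw [Finset.sum_const, nsmul_eq_mul, Finset.sum_add_distrib, ← Finset.mul_sum,
      Finset.sum_const, nsmul_eq_mul] at h1
    have h2 : ∑ j ∈ G.filter (fun j => q j = q i), g j ≤ ∑ i ∈ G, g i :=
      Finset.sum_le_sum_of_subset_of_nonneg (Finset.filter_subset _ _) fun _ _ _ => hg _
    have h3 := mul_le_mul_of_nonneg_left h2 ha
    have h4 : g i ≤ a * (∑ i ∈ G, g i) / n + b := by
      rw [← sub_le_iff_le_add, le_div_iff₀ hn0]
      linarith
    refine h4.trans ?_
    have h5 : a * (∑ i ∈ G, g i) / n ≤ a * (∑ i ∈ G, g i) / s₀ :=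
      div_le_div_of_nonneg_left (by positivity) hs₀ hn
    rw [div_mul_eq_mul_div]
    linarith
  have hc : 0 ≤ a / s₀ * ∑ i ∈ G, g i + b := by positivity
  calc ∑ i ∈ G, y i * g i ≤ ∑ i ∈ G, y i * (a / s₀ * ∑ i ∈ G, g i + b) :=
        Finset.sum_le_sum fun i hi => mul_le_mul_of_nonneg_left (key i hi) (hy i)
    _ ≤ h * (a / s₀ * ∑ i ∈ G, g i + b) := by
        rw [← Finset.sum_mul]
        exact mul_le_mul_of_nonneg_right hyh hc
    _ = _ := by ring

/-- Outliers inside `G` save at most `η * A + η * U` (`hsmall`) and can be put back. What remains is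
the cost outside `G`, where the weights agree, plus the vanilla cost on `G`, which `w` preserves. -/
theorem robustCost_approx_of_large_clusters [Fintype ι] [DecidableEq ι] (q : ι → κ) (hw : ∀ i, 0 ≤ w i)
    (hwG : ∀ i ∉ G, w i = 1) (hh : 0 ≤ h) (hs₀ : 0 < s₀) (ha : 0 ≤ a) (hb : 0 ≤ b)
    (hη : 0 < η) (hη' : η ≤ 1 / 10)
    (hlarge : ∀ i ∈ G, s₀ ≤ ((G.filter fun j => q j = q i).card : ℝ))
    (hgg : ∀ i ∈ G, ∀ j ∈ G, q j = q i →
      centerDist (x i) C ^ z ≤ a * centerDist (x j) C ^ z + b)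
    (hU : U ≤ robustCost z h x (fun _ => 1) C) (has : h * (a / s₀) ≤ η) (hhb : h * b ≤ η * U)
    (hlow : (1 - η) * ∑ i ∈ G, centerDist (x i) C ^ z ≤ ∑ i ∈ G, w i * centerDist (x i) C ^ z)
    (hupp : ∑ i ∈ G, w i * centerDist (x i) C ^ z ≤ (1 + η) * ∑ i ∈ G, centerDist (x i) C ^ z) :
    (1 - 10 * η) * robustCost z h x (fun _ => 1) C ≤ robustCost z h x w C ∧
      robustCost z h x w C ≤ (1 + 10 * η) * robustCost z h x (fun _ => 1) C := by
  have hR := robustCost_nonneg (z := z) (x := x) (C := C) (w := fun _ => 1)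
    (fun _ => zero_le_one) hh
  set R := robustCost z h x (fun _ => 1) C with hRdef
  set g : ι → ℝ := fun i => centerDist (x i) C ^ z with hgdef
  have hg : ∀ i, 0 ≤ g i := fun i => pow_nonneg (centerDist_nonneg _ _) _
  set A := ∑ i ∈ G, g i with hAdef
  have hA : 0 ≤ A := Finset.sum_nonneg fun i _ => hg i
  have hsmall : ∀ y : ι → ℝ, (∀ i, 0 ≤ y i) → ∑ i, y i ≤ h →
      ∑ i ∈ G, y i * g i ≤ η * A + η * U := by
    intro y hy hyh
    have h1 := sum_mul_le_of_large_clusters q hg hy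
      ((Finset.sum_le_sum_of_subset_of_nonneg (Finset.subset_univ G) fun i _ _ => hy i).trans hyh)
      hs₀ ha hb hlarge hgg
    have h2 := mul_le_mul_of_nonneg_right has hA
    linarith
  have hcost : ∀ (u y : ι → ℝ), cost z x (fun i => u i - y i) C =
      ∑ i ∈ Gᶜ, (u i - y i) * g i + (∑ i ∈ G, u i * g i - ∑ i ∈ G, y i * g i) := by
    intro u y
    rw [← Finset.sum_sub_distrib, cost, ← Finset.sum_add_sum_compl G, add_comm]
    simp only [sub_mul, hgdef]
  have hcut : ∀ (u y : ι → ℝ), cost z x (fun i => u i - if i ∈ G then 0 else y i) C =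
      ∑ i ∈ Gᶜ, (u i - y i) * g i + ∑ i ∈ G, u i * g i := by
    intro u y
    rw [hcost u fun i => if i ∈ G then 0 else y i]
    have h1 : ∑ i ∈ G, (if i ∈ G then 0 else y i) * g i = 0 :=
      Finset.sum_eq_zero fun i hi => by rw [if_pos hi, zero_mul]
    rw [h1, sub_zero]
    congr 1
    exact Finset.sum_congr rfl fun i hi => by rw [if_neg (Finset.mem_compl.1 hi)]
  have hcutsum : ∀ y : ι → ℝ, (∀ i, 0 ≤ y i) →
      ∑ i, (if i ∈ G then 0 else y i) ≤ ∑ i, y i := fun y hy =>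
    Finset.sum_le_sum fun i _ => by split_ifs <;> simp [hy i]
  have hoff : ∀ y : ι → ℝ, ∑ i ∈ Gᶜ, (w i - y i) * g i = ∑ i ∈ Gᶜ, (1 - y i) * g i := fun y =>
    Finset.sum_congr rfl fun i hi => by rw [hwG i (Finset.mem_compl.1 hi)]
  constructor
  · refine le_robustCost hw hh fun y hy hyh => ?_
    have h1 : R ≤ cost z x (fun i => 1 - if i ∈ G then 0 else y i) C := by
      refine robustCost_le (w := fun _ => 1) (fun i => ?_)
        ((hcutsum y fun i => (hy i).1).trans hyh)
      split_ifs with hi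
      · simp
      · exact ⟨(hy i).1, (hwG i hi) ▸ (hy i).2⟩
    rw [hcut (fun _ => 1) y] at h1
    simp only [one_mul] at h1
    have h2 := hsmall y (fun i => (hy i).1) hyh
    rw [hcost, hoff]
    have h3 : 0 ≤ ∑ i ∈ Gᶜ, (1 - y i) * g i := Finset.sum_nonneg fun i hi =>
      mul_nonneg (sub_nonneg.2 ((hwG i (Finset.mem_compl.1 hi)) ▸ (hy i).2)) (hg i)
    have h4 := mul_le_mul_of_nonneg_left hU hη.le
    have h5 := mul_le_mul_of_nonneg_left h1 (show 0 ≤ 1 - 2 * η by linarith)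
    have h6 := mul_nonneg hη.le hR
    have h7 := mul_nonneg hη.le h3
    linarith
  · have hpos : 0 < 1 + 10 * η := by linarith
    rw [← div_le_iff₀' hpos]
    refine le_robustCost (fun _ => zero_le_one) hh fun y hy hyh => ?_
    rw [div_le_iff₀' hpos]
    have hRc : R ≤ cost z x (fun i => 1 - y i) C := robustCost_le (w := fun _ => 1) hy hyh
    have h1 : robustCost z h x w C ≤ cost z x (fun i => w i - if i ∈ G then 0 else y i) C := by
      refine robustCost_le (fun i => ?_) ((hcutsum y fun i => (hy i).1).trans hyh)
      split_ifs with hi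
      · simp [hw i]
      · exact ⟨(hy i).1, (hwG i hi).symm ▸ (hy i).2⟩
    rw [hcut w y, hoff] at h1
    refine h1.trans ?_
    have h2 := hsmall y (fun i => (hy i).1) hyh
    have h3 : 0 ≤ ∑ i ∈ Gᶜ, (1 - y i) * g i := Finset.sum_nonneg fun i _ =>
      mul_nonneg (sub_nonneg.2 (hy i).2) (hg i)
    have h4 := hcost (fun _ => 1) y
    simp only [one_mul] at h4
    set c := cost z x (fun i => 1 - y i) C
    set F := ∑ i ∈ Gᶜ, (1 - y i) * g i
    have h5 : η * U ≤ η * c := mul_le_mul_of_nonneg_left (hU.trans hRc) hη.le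
    have hc : 0 ≤ c := hR.trans hRc
    have h6 : (1 - η) * A ≤ (1 + η) * c - F := by linarith
    have h7 := mul_le_mul_of_nonneg_left h6 (show 0 ≤ 1 + η by linarith)
    have h8 := mul_nonneg hη.le h3
    have h9 := mul_nonneg hη.le hc
    have h10 := mul_nonneg hη.le h8
    refine le_of_mul_le_mul_left ?_ (show 0 < 1 - η by linarith)
    have h11 : (1 - η) * (F + ∑ i ∈ G, w i * g i) ≤ (1 - η) * (F + (1 + η) * A) :=
      mul_le_mul_of_nonneg_left (by linarith) (by linarith)
    refine h11.trans ?_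
    nlinarith [mul_le_mul_of_nonneg_left hη' h9]

end Dense

/-! ### Datasets whose pieces are lifted to different heights -/

section Lifted

variable {V V' ι : Type*} [PseudoMetricSpace V] [PseudoMetricSpace V']

/-- A product-like map: `lift p a` is the point `p` at height `a`. -/
structure IsLift (lift : V → ℝ → V') : Prop where
  dist_le_dist : ∀ u v a b, dist u v ≤ dist (lift u a) (lift v b)
  abs_le_dist : ∀ u v a b, |a - b| ≤ dist (lift u a) (lift v b)
  dist_le_add : ∀ u v a b, dist (lift u a) (lift v b) ≤ dist u v + |a - b|

/-- The weights `v` on the points of `G` preserve the vanilla cost up to a factor `1 ± e`. -/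
def Preserves (k z : ℕ) (e : ℝ) (G : Finset ι) (y : ι → V') (v : ι → ℝ) : Prop :=
  ∀ C : Fin k → V',
    (1 - e) * ∑ i ∈ G, centerDist (y i) C ^ z ≤ ∑ i ∈ G, v i * centerDist (y i) C ^ z ∧
      ∑ i ∈ G, v i * centerDist (y i) C ^ z ≤ (1 + e) * ∑ i ∈ G, centerDist (y i) C ^ z

theorem Preserves.mono {k z : ℕ} {e e' : ℝ} {G : Finset ι} {y : ι → V'} {v : ι → ℝ}
    (h : Preserves k z e G y v) (he : e ≤ e') : Preserves k z e' G y v := by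
  intro C
  have h0 : 0 ≤ ∑ i ∈ G, centerDist (y i) C ^ z :=
    Finset.sum_nonneg fun i _ => pow_nonneg (centerDist_nonneg _ _) _
  have := mul_le_mul_of_nonneg_right he h0
  constructor <;> linarith [h C]

variable {k k' p z : ℕ} {lift : V → ℝ → V'} {x : ι → V} {G : Finset ι} {q : ι → Fin k}
  {ctr : Fin k → V} {π : Fin k → Fin k} {col : Fin k → Fin p} {v : ι → ℝ}
  {H M e r T : ℝ}

/-- In the lifted dataset, the mass of every piece is approximately preserved. -/
theorem mass_approx (hlift : IsLift lift) (hz : 1 ≤ z) (hk' : k + 1 ≤ k') (hv : ∀ i ∈ G, 0 ≤ v i)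
    (hP : Preserves k' z e G (fun i => lift (x i) (H * (π (q i) : ℕ))) v)
    (he : 0 < e) (he' : e ≤ 1 / 10) (hH : 0 < H) (hM0 : 0 ≤ M)
    (hM : ∀ i ∈ G, ∀ a, dist (x i) (ctr a) ≤ M) (hMH : 2 * z * M ≤ e * H)
    (hMH' : 2 * G.card * M ^ z ≤ e * H ^ z) (a : Fin k) :
    (1 - 4 * e) * ((G.filter fun i => π (q i) = a).card : ℝ) ≤ ∑ i ∈ G with π (q i) = a, v i ∧
      ∑ i ∈ G with π (q i) = a, v i ≤
        (1 + 4 * e) * ((G.filter fun i => π (q i) = a).card : ℝ) := by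
  classical
  set y : ι → V' := fun i => lift (x i) (H * (π (q i) : ℕ)) with hy
  have hHz : 0 < H ^ z := by positivity
  have hupow : (H + M) ^ z ≤ (1 + e) * H ^ z :=
    add_pow_le_of_le_mul hz hH.le hM0 (by linarith) hMH
  -- Test centers for piece `a`: its own centers are replaced by a point one step `H` below it, so
  -- each of its points pays about `H ^ z`, while all other pieces keep their centers and pay at
  -- most `M ^ z` per point. The slot `none` provides this point even if no cluster has label `a`.
  have centers : ∀ a : Fin k, ∃ C : Fin k' → V', ∀ i ∈ G,
      (π (q i) = a → H ^ z ≤ centerDist (y i) C ^ z ∧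
        centerDist (y i) C ^ z ≤ (1 + e) * H ^ z) ∧
      (π (q i) ≠ a → centerDist (y i) C ^ z ≤ M ^ z) := by
    intro a
    let ext : V' := lift (ctr a) (H * (a : ℕ) - H)
    obtain ⟨C, hC⟩ := exists_reindex_centers (k := k') (κ := Option (Fin k))
      (fun Q => Q.elim ext fun Q => if π Q = a then ext else lift (ctr Q) (H * (π Q : ℕ)))
      (by simpa using hk')
    have hext : ∀ i, π (q i) = a → H ≤ dist (y i) ext := by
      intro i hi
      have := hlift.abs_le_dist (x i) (ctr a) (H * (π (q i) : ℕ)) (H * (a : ℕ) - H)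
      rw [hi, sub_sub_cancel, abs_of_pos hH] at this
      simpa only [hy, hi] using this
    refine ⟨C, fun i hi => ⟨fun hia => ⟨?_, ?_⟩, fun hia => ?_⟩⟩
    · refine pow_le_pow_left₀ hH.le ?_ z
      obtain ⟨Q, hQ⟩ := (hC (y i)).2
      rw [hQ]
      rcases Q with _ | Q
      · exact hext i hia
      · simp only [Option.elim_some]
        split_ifs with hQa
        · exact hext i hia
        · refine le_trans ?_ (hlift.abs_le_dist _ _ _ _)
          rw [← mul_sub, abs_mul, abs_of_pos hH, hia]
          refine le_mul_of_one_le_right hH.le ?_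
          have : ((a : ℕ) : ℤ) - ((π Q : ℕ) : ℤ) ≠ 0 := by
            intro h
            exact hQa (Fin.ext (by omega))
          exact_mod_cast Int.one_le_abs this
    · refine (pow_le_pow_left₀ (centerDist_nonneg _ _) ?_ z).trans hupow
      refine ((hC (y i)).1 none).trans ((hlift.dist_le_add _ _ _ _).trans ?_)
      rw [hia, sub_sub_cancel, abs_of_pos hH]
      linarith [hM i hi a]
    · refine pow_le_pow_left₀ (centerDist_nonneg _ _) ?_ z
      refine ((hC (y i)).1 (some (q i))).trans ?_
      simp only [Option.elim_some, if_neg hia]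
      refine (hlift.dist_le_add _ _ _ _).trans ?_
      rw [sub_self, abs_zero, add_zero]
      exact hM i hi _
  have hn : ∀ a : Fin k, (0 : ℝ) ≤ (G.filter fun i => π (q i) = a).card := fun a => by positivity
  have hone : ∀ a : Fin k, (G.filter fun i => π (q i) = a).Nonempty →
      (1 : ℝ) ≤ (G.filter fun i => π (q i) = a).card := fun a h => by
    exact_mod_cast Finset.card_pos.2 h
  have hMz : (0 : ℝ) ≤ M ^ z := by positivity
  have hGM : (G.card : ℝ) * M ^ z ≤ e / 2 * H ^ z := by linarith
  have hupper : ∀ a : Fin k, ∑ i ∈ G with π (q i) = a, v i ≤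
      (1 + 4 * e) * ((G.filter fun i => π (q i) = a).card : ℝ) := by
    intro a
    rcases (G.filter fun i => π (q i) = a).eq_empty_or_nonempty with h0 | h0
    · simp [h0]
    obtain ⟨C, hC⟩ := centers a
    have h1 := (hP C).2
    have h2 : (∑ i ∈ G with π (q i) = a, v i) * H ^ z ≤
        ∑ i ∈ G, v i * centerDist (y i) C ^ z := by
      rw [Finset.sum_mul]
      refine (Finset.sum_le_sum fun i hi => ?_).trans
        (Finset.sum_le_sum_of_subset_of_nonneg (Finset.filter_subset _ _) fun i hi _ =>
          mul_nonneg (hv i hi) (pow_nonneg (centerDist_nonneg _ _) _))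
      have hi := Finset.mem_filter.1 hi
      exact mul_le_mul_of_nonneg_left ((hC i hi.1).1 hi.2).1 (hv i hi.1)
    have h3 : ∑ i ∈ G, centerDist (y i) C ^ z ≤
        ((G.filter fun i => π (q i) = a).card : ℝ) * ((1 + e) * H ^ z) + G.card * M ^ z := by
      rw [← Finset.sum_filter_add_sum_filter_not G fun i => π (q i) = a]
      refine add_le_add ?_ ?_
      · rw [← nsmul_eq_mul, ← Finset.sum_const]
        refine Finset.sum_le_sum fun i hi => ?_
        have hi := Finset.mem_filter.1 hi
        exact ((hC i hi.1).1 hi.2).2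
      · refine (Finset.sum_le_sum fun i hi => ?_ : _ ≤ ∑ i ∈ G with ¬ π (q i) = a, M ^ z).trans ?_
        · have hi := Finset.mem_filter.1 hi
          exact (hC i hi.1).2 hi.2
        · rw [Finset.sum_const, nsmul_eq_mul]
          exact mul_le_mul_of_nonneg_right
            (by exact_mod_cast Finset.card_le_card (Finset.filter_subset _ _)) hMz
    refine le_of_mul_le_mul_right ?_ hHz
    have h4 := mul_le_mul_of_nonneg_left h3 (show 0 ≤ 1 + e by linarith)
    have h5 := hone a h0
    set N : ℝ := ((G.filter fun i => π (q i) = a).card : ℝ)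
    have h6 := mul_le_mul_of_nonneg_left hGM (show 0 ≤ 1 + e by linarith)
    have h7 : (1 + e) * (e / 2 * H ^ z) ≤ N * ((1 + e) * (e / 2) * H ^ z) := by
      have : 0 ≤ (1 + e) * (e / 2) * H ^ z := by positivity
      nlinarith
    have h8 : N * ((1 + e) * (1 + e) + (1 + e) * (e / 2)) * H ^ z ≤ (1 + 4 * e) * N * H ^ z := by
      refine mul_le_mul_of_nonneg_right ?_ hHz.le
      rw [mul_comm]
      refine mul_le_mul_of_nonneg_right ?_ (hn a)
      nlinarith
    linarith
  refine ⟨?_, hupper a⟩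
  rcases (G.filter fun i => π (q i) = a).eq_empty_or_nonempty with h0 | h0
  · simp [h0]
  -- For the lower bound, the other pieces must not make up for missing mass by their own cost; this
  -- requires control of the total mass, which the upper bounds give.
  have htot : ∑ i ∈ G, v i ≤ 2 * G.card := by
    rw [← Finset.sum_fiberwise_of_maps_to (s := G) (t := Finset.univ) (g := fun i => π (q i))
      fun _ _ => Finset.mem_univ _]
    refine (Finset.sum_le_sum fun a _ => hupper a).trans ?_
    rw [← Finset.mul_sum]
    have : (G.card : ℝ) = ∑ a : Fin k, ((G.filter fun i => π (q i) = a).card : ℝ) := by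
      exact_mod_cast Finset.card_eq_sum_card_fiberwise (s := G) (t := Finset.univ)
        (f := fun i => π (q i)) fun _ _ => Finset.mem_coe.2 (Finset.mem_univ _)
    rw [← this]
    have : (0 : ℝ) ≤ G.card := by positivity
    nlinarith
  obtain ⟨C, hC⟩ := centers a
  have h1 := (hP C).1
  have h2 : ((G.filter fun i => π (q i) = a).card : ℝ) * H ^ z ≤
      ∑ i ∈ G, centerDist (y i) C ^ z := by
    rw [← nsmul_eq_mul, ← Finset.sum_const]
    refine (Finset.sum_le_sum fun i hi => ?_).trans
      (Finset.sum_le_sum_of_subset_of_nonneg (Finset.filter_subset (fun i => π (q i) = a) G)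
        fun i hi _ => pow_nonneg (centerDist_nonneg (y i) C) z)
    have hi := Finset.mem_filter.1 hi
    exact ((hC i hi.1).1 hi.2).1
  have h3 : ∑ i ∈ G, v i * centerDist (y i) C ^ z ≤
      (∑ i ∈ G with π (q i) = a, v i) * ((1 + e) * H ^ z) + 2 * G.card * M ^ z := by
    rw [← Finset.sum_filter_add_sum_filter_not G fun i => π (q i) = a]
    refine add_le_add ?_ ?_
    · rw [Finset.sum_mul]
      refine Finset.sum_le_sum fun i hi => ?_
      have hi := Finset.mem_filter.1 hi
      exact mul_le_mul_of_nonneg_left ((hC i hi.1).1 hi.2).2 (hv i hi.1)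
    · refine (Finset.sum_le_sum fun i hi => ?_ :
        _ ≤ ∑ i ∈ G with ¬ π (q i) = a, v i * M ^ z).trans ?_
      · have hi := Finset.mem_filter.1 hi
        exact mul_le_mul_of_nonneg_left ((hC i hi.1).2 hi.2) (hv i hi.1)
      · rw [← Finset.sum_mul]
        refine mul_le_mul_of_nonneg_right (le_trans ?_ htot) hMz
        exact Finset.sum_le_sum_of_subset_of_nonneg (Finset.filter_subset _ _)
          fun i hi _ => hv i hi
  have h5 := hone a h0
  have h4 := mul_le_mul_of_nonneg_left h2 (show 0 ≤ 1 - e by linarith)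
  set N : ℝ := ((G.filter fun i => π (q i) = a).card : ℝ)
  set W := ∑ i ∈ G with π (q i) = a, v i
  have h6 : e * H ^ z ≤ N * (e * H ^ z) := le_mul_of_one_le_left (by positivity) h5
  have h7 : (1 - 2 * e) * N * H ^ z ≤ W * (1 + e) * H ^ z := by linarith
  have h8 := le_of_mul_le_mul_right h7 hHz
  refine le_of_mul_le_mul_right ?_ (show 0 < 1 + e by linarith)
  have h9 : N * ((1 - 4 * e) * (1 + e)) ≤ N * (1 - 2 * e) :=
    mul_le_mul_of_nonneg_left (by nlinarith) (hn a)
  linarith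

/-- Centers for the lifted dataset that simulate the centers `C` on the pieces in `N` and have
small cost on the other pieces. -/
theorem exists_lifted_centers (hlift : IsLift lift) (hz : 1 ≤ z) (hk : 1 ≤ k)
    (hk' : k * p + k ≤ k') (he : e ≤ 1) (hr : 0 ≤ r) (hH : 0 ≤ H)
    (hrad : ∀ i ∈ G, dist (x i) (ctr (q i)) ≤ r) (hrT : 2 * z * (2 * r) ≤ e * T)
    (hsparse : ∀ Q Q', col Q = col Q' → dist (ctr Q) (ctr Q') ≤ 2 * (T + r) → π Q = π Q')
    (C : Fin k → V) (N : Finset (Fin k))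
    (hN : ∀ i ∈ G, π (q i) ∈ N → centerDist (x i) C ≤ H) (he0 : 0 ≤ e) :
    ∃ C' : Fin k' → V', ∀ i ∈ G,
      (π (q i) ∈ N →
        centerDist (x i) C ^ z ≤ centerDist (lift (x i) (H * (π (q i) : ℕ))) C' ^ z ∧
        centerDist (lift (x i) (H * (π (q i) : ℕ))) C' ^ z ≤ (1 + e) * centerDist (x i) C ^ z) ∧
      (π (q i) ∉ N → centerDist (lift (x i) (H * (π (q i) : ℕ))) C' ^ z ≤ r ^ z) := by
  classical
  have : Nonempty (Fin k) := ⟨⟨0, hk⟩⟩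
  choose near hnear using fun Q => exists_centerDist_eq hk (ctr Q) C
  -- By `hsparse`, all clusters of color `χ` with center within `T + r` of `C j` have the same
  -- label. One copy of `C j` per color, at the height of that label, therefore serves all short
  -- distances.
  let height : Fin k → Fin p → ℝ := fun j χ =>
    if h : ∃ Q, col Q = χ ∧ dist (C j) (ctr Q) ≤ T + r then H * (π h.choose : ℕ) else 0
  have hheight : ∀ j Q, dist (C j) (ctr Q) ≤ T + r → height j (col Q) = H * (π Q : ℕ) := by
    intro j Q hQ
    have hex : ∃ Q', col Q' = col Q ∧ dist (C j) (ctr Q') ≤ T + r := ⟨Q, rfl, hQ⟩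
    have hs := hex.choose_spec
    simp only [height, dif_pos hex]
    rw [hsparse _ Q hs.1 ?_]
    have := dist_triangle_left (ctr hex.choose) (ctr Q) (C j)
    linarith [hs.2]
  obtain ⟨C', hC'⟩ := exists_reindex_centers (k := k') (κ := (Fin k × Fin p) ⊕ Fin k)
    (Sum.elim (fun jχ => lift (C jχ.1) (height jχ.1 jχ.2)) fun Q =>
      if π Q ∈ N then lift (C (near Q)) (H * (π Q : ℕ)) else lift (ctr Q) (H * (π Q : ℕ)))
    (by simpa using hk')
  refine ⟨C', fun i hi => ⟨fun hiN => ⟨?_, ?_⟩, fun hiN => ?_⟩⟩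
  · refine pow_le_pow_left₀ (centerDist_nonneg _ _) ?_ z
    obtain ⟨κ, hκ⟩ := (hC' (lift (x i) (H * (π (q i) : ℕ)))).2
    rw [hκ]
    rcases κ with ⟨j, χ⟩ | Q
    · exact (centerDist_le _ _ j).trans (hlift.dist_le_dist _ _ _ _)
    · simp only [Sum.elim_inr]
      split_ifs with hQ
      · exact (centerDist_le _ _ _).trans (hlift.dist_le_dist _ _ _ _)
      -- This center sits at the height of another piece, hence at distance at least `H`.
      · refine (hN i hi hiN).trans (le_trans ?_ (hlift.abs_le_dist _ _ _ _))
        rw [← mul_sub, abs_mul, abs_of_nonneg hH]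
        refine le_mul_of_one_le_right hH ?_
        have : ((π (q i) : ℕ) : ℤ) - ((π Q : ℕ) : ℤ) ≠ 0 := by
          intro h
          have : π (q i) = π Q := Fin.ext (by omega)
          exact hQ (this ▸ hiN)
        exact_mod_cast Int.one_le_abs this
  · have hd := centerDist_nonneg (x i) C
    obtain ⟨j, hj⟩ := exists_centerDist_eq hk (x i) C
    -- Below `T` a copy of the true nearest center is available. Above `T` the center nearest to
    -- `ctr (q i)` is used instead; its excess `2 * r` is negligible against `T` by `hrT`.
    rcases le_total (centerDist (x i) C) T with hT | hT
    · have h1 : dist (C j) (ctr (q i)) ≤ T + r := by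
        have := dist_triangle_left (C j) (ctr (q i)) (x i)
        linarith [hrad i hi]
      have h2 := (hC' (lift (x i) (H * (π (q i) : ℕ)))).1 (.inl (j, col (q i)))
      simp only [Sum.elim_inl, hheight j _ h1] at h2
      have h3 := hlift.dist_le_add (x i) (C j) (H * (π (q i) : ℕ)) (H * (π (q i) : ℕ))
      rw [sub_self, abs_zero, add_zero, ← hj] at h3
      refine (pow_le_pow_left₀ (centerDist_nonneg _ _) (h2.trans h3) z).trans ?_
      exact le_mul_of_one_le_left (by positivity) (by linarith)
    · have h2 := (hC' (lift (x i) (H * (π (q i) : ℕ)))).1 (.inr (q i))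
      simp only [Sum.elim_inr, if_pos hiN] at h2
      have h3 := hlift.dist_le_add (x i) (C (near (q i))) (H * (π (q i) : ℕ)) (H * (π (q i) : ℕ))
      rw [sub_self, abs_zero, add_zero] at h3
      have h4 := dist_triangle (x i) (ctr (q i)) (C (near (q i)))
      rw [← hnear] at h4
      have h5 := centerDist_le_add (ctr (q i)) (x i) C
      rw [dist_comm] at h5
      have h6 := hrad i hi
      refine (pow_le_pow_left₀ (centerDist_nonneg _ _)
        (show _ ≤ centerDist (x i) C + 2 * r by linarith) z).trans ?_
      exact add_pow_le_of_le_mul hz hd (by linarith) he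
        (hrT.trans (mul_le_mul_of_nonneg_left hT he0))
  · refine pow_le_pow_left₀ (centerDist_nonneg _ _) ?_ z
    have h2 := (hC' (lift (x i) (H * (π (q i) : ℕ)))).1 (.inr (q i))
    simp only [Sum.elim_inr, if_neg hiN] at h2
    have h3 := hlift.dist_le_add (x i) (ctr (q i)) (H * (π (q i) : ℕ)) (H * (π (q i) : ℕ))
    rw [sub_self, abs_zero, add_zero] at h3
    exact h2.trans (h3.trans (hrad i hi))

end Lifted

/-! ### Restoring the masses of the pieces and comparing robust costs. -/

section Rescaled

variable {V V' ι : Type*} [PseudoMetricSpace V] [PseudoMetricSpace V'] [DecidableEq ι]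
variable {k k' p z m : ℕ} {lift : V → ℝ → V'} {x : ι → V} {G : Finset ι} {q : ι → Fin k}
  {ctr : Fin k → V} {π : Fin k → Fin k} {col : Fin k → Fin p} {v : ι → ℝ}
  {H M e r T T' Δ h U : ℝ} {C : Fin k → V}

/-- The weights `v`, scaled in such a way that every piece has its original mass; the points
outside `G` have weight `1`. -/
def rescale (G : Finset ι) (lab : ι → Fin k) (v : ι → ℝ) (i : ι) : ℝ :=
  if i ∈ G then v i * (((G.filter fun j => lab j = lab i).card : ℝ) /
    ∑ j ∈ G with lab j = lab i, v j) else 1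

theorem rescale_nonneg (lab : ι → Fin k) (hv : ∀ i ∈ G, 0 ≤ v i) (i : ι) :
    0 ≤ rescale G lab v i := by
  rw [rescale]
  split_ifs with hi
  · exact mul_nonneg (hv i hi) (div_nonneg (by positivity)
      (Finset.sum_nonneg fun j hj => hv j (Finset.mem_filter.1 hj).1))
  · exact zero_le_one

/-- The weights of a coreset of the lifted dataset, rescaled on the pieces, preserve the cost of
the family of pieces that are near the centers. -/
theorem near_cost_approx (N : Finset (Fin k)) (lab : ι → Fin k) {g : ι → ℝ} {y : ι → V'}
    {C' : Fin k' → V'} (hg : ∀ i, 0 ≤ g i) (hv : ∀ i ∈ G, 0 ≤ v i)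
    (hP : Preserves k' z e G y v) (he : 0 < e) (he' : e ≤ 1 / 40) (hr : 0 ≤ r)
    (hmass : ∀ a, (1 - 4 * e) * ((G.filter fun i => lab i = a).card : ℝ) ≤
        ∑ i ∈ G with lab i = a, v i ∧
      ∑ i ∈ G with lab i = a, v i ≤ (1 + 4 * e) * ((G.filter fun i => lab i = a).card : ℝ))
    (hC' : ∀ i ∈ G, (lab i ∈ N → g i ≤ centerDist (y i) C' ^ z ∧
        centerDist (y i) C' ^ z ≤ (1 + e) * g i) ∧
      (lab i ∉ N → centerDist (y i) C' ^ z ≤ r ^ z)) :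
    ∑ i ∈ G with lab i ∈ N, rescale G lab v i * g i ≤ ∑ i ∈ G with lab i ∈ N, g i +
        (10 * e * ∑ i ∈ G with lab i ∈ N, g i +
          2 * ((G.filter fun i => lab i ∉ N).card * r ^ z)) ∧
      ∑ i ∈ G with lab i ∈ N, g i ≤ ∑ i ∈ G with lab i ∈ N, rescale G lab v i * g i +
        (10 * e * ∑ i ∈ G with lab i ∈ N, g i +
          2 * ((G.filter fun i => lab i ∉ N).card * r ^ z)) := by
  have hrz : 0 ≤ r ^ z := pow_nonneg hr z
  set A := ∑ i ∈ G with lab i ∈ N, g i with hA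
  set S := ∑ i ∈ G with lab i ∈ N, v i * g i with hS
  set B := ((G.filter fun i => lab i ∉ N).card : ℝ) * r ^ z with hB
  have hA0 : 0 ≤ A := Finset.sum_nonneg fun i _ => hg i
  have hS0 : 0 ≤ S := Finset.sum_nonneg fun i hi =>
    mul_nonneg (hv i (Finset.mem_filter.1 hi).1) (hg i)
  have hB0 : 0 ≤ B := by positivity
  -- The scaling factor is the inverse of a number in `[1 - 4 * e, 1 + 4 * e]`; the upper bound uses
  -- `(1 + 5 * e) * (1 - 4 * e) ≥ 1`.
  have hscale : ∀ i ∈ G, (1 - 4 * e) * v i ≤ rescale G lab v i ∧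
      rescale G lab v i ≤ (1 + 5 * e) * v i := by
    intro i hi
    have hvi := hv i hi
    obtain ⟨h1, h2⟩ := hmass (lab i)
    have h3 : (1 : ℝ) ≤ ((G.filter fun j => lab j = lab i).card : ℝ) := by
      exact_mod_cast Finset.card_pos.2 (⟨i, Finset.mem_filter.2 ⟨hi, rfl⟩⟩ :
        (G.filter fun j => lab j = lab i).Nonempty)
    rw [rescale, if_pos hi, mul_comm, mul_comm (1 + 5 * e)]
    set n : ℝ := ((G.filter fun j => lab j = lab i).card : ℝ)
    set W := ∑ j ∈ G with lab j = lab i, v j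
    have hW : 0 < W := lt_of_lt_of_le (by nlinarith) h1
    constructor
    · refine mul_le_mul_of_nonneg_left ?_ hvi
      rw [le_div_iff₀ hW]
      have := mul_le_mul_of_nonneg_left h2 (show 0 ≤ 1 - 4 * e by linarith)
      nlinarith
    · refine mul_le_mul_of_nonneg_left ?_ hvi
      rw [div_le_iff₀ hW]
      have := mul_le_mul_of_nonneg_left h1 (show 0 ≤ 1 + 5 * e by linarith)
      nlinarith
  have hup : S ≤ (1 + e) * ((1 + e) * A + B) := by
    have h1 := (hP C').2
    have h2 : S ≤ ∑ i ∈ G, v i * centerDist (y i) C' ^ z := by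
      refine (Finset.sum_le_sum fun i hi => ?_).trans
        (Finset.sum_le_sum_of_subset_of_nonneg (Finset.filter_subset _ _) fun i hi _ =>
          mul_nonneg (hv i hi) (pow_nonneg (centerDist_nonneg _ _) _))
      have hi := Finset.mem_filter.1 hi
      exact mul_le_mul_of_nonneg_left ((hC' i hi.1).1 hi.2).1 (hv i hi.1)
    have h3 : ∑ i ∈ G, centerDist (y i) C' ^ z ≤ (1 + e) * A + B := by
      rw [← Finset.sum_filter_add_sum_filter_not G fun i => lab i ∈ N]
      refine add_le_add ?_ ?_
      · rw [hA, Finset.mul_sum]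
        refine Finset.sum_le_sum fun i hi => ?_
        have hi := Finset.mem_filter.1 hi
        exact ((hC' i hi.1).1 hi.2).2
      · rw [hB, ← nsmul_eq_mul, ← Finset.sum_const]
        refine Finset.sum_le_sum fun i hi => ?_
        have hi := Finset.mem_filter.1 hi
        exact (hC' i hi.1).2 hi.2
    exact h2.trans (h1.trans (mul_le_mul_of_nonneg_left h3 (by linarith)))
  have hlo : (1 - e) * A ≤ (1 + e) * S + (1 + 4 * e) * B := by
    have h1 := (hP C').1
    have h2 : A ≤ ∑ i ∈ G, centerDist (y i) C' ^ z := by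
      refine (Finset.sum_le_sum fun i hi => ?_).trans
        (Finset.sum_le_sum_of_subset_of_nonneg (Finset.filter_subset (fun i => lab i ∈ N) G)
          fun i hi _ => pow_nonneg (centerDist_nonneg (y i) C') z)
      have hi := Finset.mem_filter.1 hi
      exact ((hC' i hi.1).1 hi.2).1
    have h3 : ∑ i ∈ G, v i * centerDist (y i) C' ^ z ≤ (1 + e) * S + (1 + 4 * e) * B := by
      rw [← Finset.sum_filter_add_sum_filter_not G fun i => lab i ∈ N]
      refine add_le_add ?_ ?_
      · rw [hS, Finset.mul_sum]
        refine Finset.sum_le_sum fun i hi => ?_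
        have hi := Finset.mem_filter.1 hi
        rw [mul_left_comm]
        exact mul_le_mul_of_nonneg_left ((hC' i hi.1).1 hi.2).2 (hv i hi.1)
      · calc ∑ i ∈ G with ¬ lab i ∈ N, v i * centerDist (y i) C' ^ z
            ≤ ∑ i ∈ G with ¬ lab i ∈ N, v i * r ^ z := by
              refine Finset.sum_le_sum fun i hi => ?_
              have hi := Finset.mem_filter.1 hi
              exact mul_le_mul_of_nonneg_left ((hC' i hi.1).2 hi.2) (hv i hi.1)
          _ = (∑ a ∈ Nᶜ, ∑ i ∈ G with lab i = a, v i) * r ^ z := by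
              rw [← Finset.sum_mul, ← Finset.sum_fiberwise_of_maps_to
                (s := G.filter fun i => ¬ lab i ∈ N) (t := Nᶜ) (g := lab)
                fun i hi => Finset.mem_compl.2 (Finset.mem_filter.1 hi).2]
              congr 1
              refine Finset.sum_congr rfl fun a ha => ?_
              rw [Finset.filter_filter]
              refine Finset.sum_congr (Finset.filter_congr fun i _ => ?_) fun _ _ => rfl
              exact ⟨fun h => h.2, fun h => ⟨h ▸ Finset.mem_compl.1 ha, h⟩⟩
          _ ≤ (∑ a ∈ Nᶜ, (1 + 4 * e) * ((G.filter fun i => lab i = a).card : ℝ)) * r ^ z :=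
              mul_le_mul_of_nonneg_right (Finset.sum_le_sum fun a _ => (hmass a).2) hrz
          _ = (1 + 4 * e) * B := by
              rw [← Finset.mul_sum, hB, Finset.card_eq_sum_card_fiberwise
                (s := G.filter fun i => lab i ∉ N) (t := Nᶜ) (f := lab)
                fun i hi => Finset.mem_coe.2 (Finset.mem_compl.2
                  (Finset.mem_filter.1 (Finset.mem_coe.1 hi)).2)]
              rw [mul_assoc, Nat.cast_sum]
              congr 2
              refine Finset.sum_congr rfl fun a ha => ?_
              rw [Finset.filter_filter]
              congr 2
              refine Finset.filter_congr fun i _ => ?_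
              exact ⟨fun h => ⟨h ▸ Finset.mem_compl.1 ha, h⟩, fun h => h.2⟩
    exact (mul_le_mul_of_nonneg_left h2 (by linarith)).trans (h1.trans h3)
  have hw1 : ∑ i ∈ G with lab i ∈ N, rescale G lab v i * g i ≤ (1 + 5 * e) * S := by
    rw [hS, Finset.mul_sum]
    refine Finset.sum_le_sum fun i hi => ?_
    rw [← mul_assoc]
    exact mul_le_mul_of_nonneg_right (hscale i (Finset.mem_filter.1 hi).1).2 (hg i)
  have hw2 : (1 - 4 * e) * S ≤ ∑ i ∈ G with lab i ∈ N, rescale G lab v i * g i := by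
    rw [hS, Finset.mul_sum]
    refine Finset.sum_le_sum fun i hi => ?_
    rw [← mul_assoc]
    exact mul_le_mul_of_nonneg_right (hscale i (Finset.mem_filter.1 hi).1).1 (hg i)
  have heA := mul_nonneg he.le hA0
  have heB := mul_nonneg he.le hB0
  have heS := mul_nonneg he.le hS0
  have heeA := mul_le_mul_of_nonneg_left he' heA
  have heeB := mul_le_mul_of_nonneg_left he' heB
  have heeS := mul_le_mul_of_nonneg_left he' heS
  have he2 : e * e ≤ 1 / 40 * e := mul_le_mul_of_nonneg_right he' he.le
  constructor
  · refine hw1.trans ?_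
    have h1 := mul_le_mul_of_nonneg_left hup (show 0 ≤ 1 + 5 * e by linarith)
    have h2 : (1 + 5 * e) * ((1 + e) * (1 + e)) ≤ 1 + 10 * e := by nlinarith
    have h3 : (1 + 5 * e) * (1 + e) ≤ 2 := by nlinarith
    have h4 := mul_le_mul_of_nonneg_right h2 hA0
    have h5 := mul_le_mul_of_nonneg_right h3 hB0
    nlinarith
  · have h1 : (1 - 10 * e) * A ≤ (1 - 4 * e) * S + 2 * B := by
      have h2 : (1 - 4 * e) * ((1 - e) * A) ≤ (1 - 4 * e) * ((1 + e) * S + (1 + 4 * e) * B) :=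
        mul_le_mul_of_nonneg_left hlo (by linarith)
      have h3 : (1 - 10 * e) * (1 + e) ≤ (1 - 4 * e) * (1 - e) := by nlinarith
      have h4 := mul_le_mul_of_nonneg_right h3 hA0
      have h5 : (1 - 4 * e) * (1 + 4 * e) ≤ 2 * (1 + e) := by nlinarith
      have h6 := mul_le_mul_of_nonneg_right h5 hB0
      refine le_of_mul_le_mul_right ?_ (show 0 < 1 + e by linarith)
      linarith
    linarith

/-- Positivity excludes a nonempty piece of total weight 0, where division by zero would give
weights 0 and lose the mass. -/
theorem sum_rescale (lab : ι → Fin k) (a : Fin k)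
    (h : (G.filter fun i => lab i = a).Nonempty → 0 < ∑ i ∈ G with lab i = a, v i) :
    ∑ i ∈ G with lab i = a, rescale G lab v i = ((G.filter fun i => lab i = a).card : ℝ) := by
  have h1 : ∑ i ∈ G with lab i = a, rescale G lab v i = ∑ i ∈ G with lab i = a,
      v i * (((G.filter fun j => lab j = a).card : ℝ) / ∑ j ∈ G with lab j = a, v j) := by
    refine Finset.sum_congr rfl fun i hi => ?_
    have hi := Finset.mem_filter.1 hi
    rw [rescale, if_pos hi.1, hi.2]
  rw [h1, ← Finset.sum_mul]
  rcases (G.filter fun i => lab i = a).eq_empty_or_nonempty with h0 | h0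
  · simp [h0]
  · have h3 := h h0
    field_simp

/-- The variant of `robustCost_le_of_mass_eq` for a partition of `G`, where the two weighted sets
agree outside `G`. -/
theorem robustCost_le_of_mass_eq_on [Fintype ι] {t b D : ℝ} {u w : ι → ℝ} (hu : ∀ i, 0 ≤ u i)
    (hw : ∀ i, 0 ≤ w i) (hh : 0 ≤ h) (ht : 1 ≤ t) (hb : 0 ≤ b) (lab : ι → Fin k)
    (N : Finset (Fin k)) (huw : ∀ i ∉ G, u i = w i)
    (hmass : ∀ a, ∑ i ∈ G with lab i = a, u i = ∑ i ∈ G with lab i = a, w i)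
    (hfar : ∀ i ∈ G, ∀ j ∈ G, lab i = lab j → lab i ∉ N →
      centerDist (x i) C ^ z ≤ t * centerDist (x j) C ^ z)
    (hnear : ∀ i ∈ G, ∀ j ∈ G, lab i = lab j → lab i ∈ N →
      centerDist (x i) C ^ z ≤ centerDist (x j) C ^ z + b)
    (hcost : ∑ i ∈ G with lab i ∈ N, w i * centerDist (x i) C ^ z ≤
      ∑ i ∈ G with lab i ∈ N, u i * centerDist (x i) C ^ z + D) :
    robustCost z h x w C ≤ t * robustCost z h x u C + (b * h + D) := by
  -- Points outside `G` become singleton pieces and count as far, where nothing has to be compared.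
  let lab' : ι → Fin k ⊕ ι := fun i => if i ∈ G then .inl (lab i) else .inr i
  let N' : Finset (Fin k ⊕ ι) := N.map Function.Embedding.inl
  have hlabN : ∀ i, lab' i ∈ N' ↔ i ∈ G ∧ lab i ∈ N := by
    intro i
    by_cases hi : i ∈ G <;> simp [lab', N', hi]
  have hlab'G : ∀ i j, lab' i = lab' j → i ∈ G → j ∈ G ∧ lab i = lab j := by
    intro i j hij hi
    by_cases hj : j ∈ G
    · simp only [lab', if_pos hi, if_pos hj] at hij
      exact ⟨hj, Sum.inl_injective hij⟩
    · simp only [lab', if_pos hi, if_neg hj] at hij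
      exact absurd hij Sum.inl_ne_inr
  have hlab'F : ∀ i j, lab' i = lab' j → i ∉ G → i = j := by
    intro i j hij hi
    by_cases hj : j ∈ G
    · simp only [lab', if_neg hi, if_pos hj] at hij
      exact absurd hij Sum.inr_ne_inl
    · simp only [lab', if_neg hi, if_neg hj] at hij
      exact Sum.inr_injective hij
  have hsumN : ∀ f : ι → ℝ, ∑ i with lab' i ∈ N', f i = ∑ i ∈ G with lab i ∈ N, f i := by
    intro f
    refine Finset.sum_congr ?_ fun _ _ => rfl
    ext i
    simp [hlabN]
  refine robustCost_le_of_mass_eq hu hw hh ht hb lab' N' ?_ ?_ ?_ (by rwa [hsumN, hsumN])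
  · rintro (a | i)
    · have hset : (Finset.univ.filter fun i => lab' i = .inl a) =
          G.filter fun i => lab i = a := by
        ext i
        by_cases hi : i ∈ G <;> simp [lab', hi]
      rw [hset]
      exact hmass a
    · refine Finset.sum_congr rfl fun j hj => ?_
      have hj := (Finset.mem_filter.1 hj).2
      by_cases hjG : j ∈ G
      · simp [lab', hjG] at hj
      · exact huw j hjG
  · intro i j hij hiN
    by_cases hi : i ∈ G
    · obtain ⟨hj, hij'⟩ := hlab'G i j hij hi
      exact hfar i hi j hj hij' fun hcon => hiN ((hlabN i).2 ⟨hi, hcon⟩)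
    · rw [hlab'F i j hij hi]
      exact le_mul_of_one_le_left (pow_nonneg (centerDist_nonneg _ _) _) ht
  · intro i j hij hiN
    obtain ⟨hi, hiN⟩ := (hlabN i).1 hiN
    obtain ⟨hj, hij'⟩ := hlab'G i j hij hi
    exact hnear i hi j hj hij' hiN

/-- A coreset of the lifted dataset, rescaled on the pieces and extended by the points outside
`G`, preserves the robust cost. -/
theorem robustCost_approx_of_lifted [Fintype ι] (hlift : IsLift lift) (hz : 1 ≤ z) (hk : 1 ≤ k)
    (hm : 1 ≤ m)
    (hk' : k * p + k ≤ k') (hk'' : k + 1 ≤ k') (hv : ∀ i ∈ G, 0 ≤ v i)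
    (hP : Preserves k' z e G (fun i => lift (x i) (H * (π (q i) : ℕ))) v)
    (he : 0 < e) (he' : e ≤ 1 / 40) (hH : 0 < H) (hr : 0 ≤ r) (hT' : 0 ≤ T') (hΔ : 0 ≤ Δ)
    (hM0 : 0 ≤ M)
    (hM : ∀ i ∈ G, ∀ a, dist (x i) (ctr a) ≤ M) (hMH : 2 * z * M ≤ e * H)
    (hMH' : 2 * G.card * M ^ z ≤ e * H ^ z)
    (hrad : ∀ i ∈ G, dist (x i) (ctr (q i)) ≤ r) (hrT : 2 * z * (2 * r) ≤ e * T)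
    (hsparse : ∀ Q Q', col Q = col Q' → dist (ctr Q) (ctr Q') ≤ 2 * (T + r) → π Q = π Q')
    (hdiam : ∀ i ∈ G, ∀ j ∈ G, π (q i) = π (q j) → dist (x i) (x j) ≤ Δ)
    (hΔT : 2 * z * Δ ≤ e * T') (hrΔ : r ≤ Δ) (hTH : T' + Δ ≤ H)
    (hU : m * T' ^ z ≤ U) (hUR : U ≤ robustCost z h x (fun _ => 1) C)
    (hh : 0 ≤ h) (hhm : h ≤ m) :
    (1 - 40 * e) * robustCost z h x (fun _ => 1) C ≤
        robustCost z h x (rescale G (fun i => π (q i)) v) C ∧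
      robustCost z h x (rescale G (fun i => π (q i)) v) C ≤
        (1 + 40 * e) * robustCost z h x (fun _ => 1) C := by
  classical
  set lab : ι → Fin k := fun i => π (q i) with hlab
  set w := rescale G lab v with hw
  have hw0 : ∀ i, 0 ≤ w i := rescale_nonneg lab hv
  set R := robustCost z h x (fun _ => 1) C with hRdef
  have hR0 : 0 ≤ R := robustCost_nonneg (fun _ => zero_le_one) hh
  set g : ι → ℝ := fun i => centerDist (x i) C ^ z with hgdef
  have hg : ∀ i, 0 ≤ g i := fun i => pow_nonneg (centerDist_nonneg _ _) _
  -- `T'` is the scale at which `m` points cost at most the lower bound `U`. By `hdiam`, near pieces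
  -- lie entirely within `T' + Δ` of the centers.
  set N : Finset (Fin k) := Finset.univ.filter fun a =>
    ∃ i ∈ G, lab i = a ∧ centerDist (x i) C ≤ T' with hNdef
  have hz' : (1 : ℝ) ≤ z := by exact_mod_cast hz
  have hm' : (1 : ℝ) ≤ m := by exact_mod_cast hm
  have hT'z : 0 ≤ T' ^ z := pow_nonneg hT' z
  have hNle : ∀ i ∈ G, lab i ∈ N → centerDist (x i) C ≤ T' + Δ := by
    intro i hi hiN
    obtain ⟨j, hj, hji, hjT⟩ := (Finset.mem_filter.1 hiN).2
    have := centerDist_le_add (x i) (x j) C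
    linarith [hdiam i hi j hj hji.symm]
  have hfarT : ∀ i ∈ G, lab i ∉ N → T' ≤ centerDist (x i) C := by
    intro i hi hiN
    by_contra! hcon
    exact hiN (Finset.mem_filter.2 ⟨Finset.mem_univ _, i, hi, rfl, hcon.le⟩)
  have hmass := mass_approx hlift hz hk'' hv hP he (by linarith) hH hM0 hM hMH hMH'
  obtain ⟨C', hC'⟩ := exists_lifted_centers hlift hz hk hk' (by linarith) hr hH.le hrad hrT hsparse
    C N (fun i hi hiN => (hNle i hi hiN).trans hTH) he.le
  obtain ⟨hN1, hN2⟩ := near_cost_approx N lab hg hv hP he he' hr hmass hC'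
  rw [← hw] at hN1 hN2
  set A := ∑ i ∈ G with lab i ∈ N, g i with hA
  set n : ℝ := ((G.filter fun i => lab i ∉ N).card : ℝ) with hn
  have hn0 : 0 ≤ n := by positivity
  have hTΔ : (T' + Δ) ^ z ≤ 2 * T' ^ z :=
    (add_pow_le_of_le_mul hz hT' hΔ (by linarith) hΔT).trans
      (mul_le_mul_of_nonneg_right (by linarith) hT'z)
  have hmT : (m : ℝ) * T' ^ z ≤ R := hU.trans hUR
  have hAR : A ≤ 3 * R := by
    have := sum_near_le (x := x) (C := C) (z := z) hh hhm (B := 2 * T' ^ z) (by positivity)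
      (G.filter fun i => lab i ∈ N) fun i hi => by
        have hi := Finset.mem_filter.1 hi
        exact (pow_le_pow_left₀ (centerDist_nonneg _ _) (hNle i hi.1 hi.2) z).trans hTΔ
    rw [← hRdef] at this
    linarith
  have hnR : n * T' ^ z ≤ 2 * R := by
    have := card_far_mul_le (x := x) (C := C) (z := z) hh hhm hT'z
      (G.filter fun i => lab i ∉ N) fun i hi => by
        have hi := Finset.mem_filter.1 hi
        exact pow_le_pow_left₀ hT' (hfarT i hi.1 hi.2) z
    rw [← hRdef] at this
    linarith
  -- The simulation charges up to `r ^ z` for every far point. This is affordable because such a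
  -- point is at distance at least `T'`, and `r ≤ e * T'`.
  have hBR : n * r ^ z ≤ 2 * e * R := by
    have h1 : r ≤ e * T' := by nlinarith
    have h2 : r ^ z ≤ e * T' ^ z := by
      refine (pow_le_pow_left₀ hr h1 z).trans ?_
      rw [mul_pow]
      exact mul_le_mul_of_nonneg_right
        (pow_le_of_le_one he.le (by linarith) (by omega)) hT'z
    calc n * r ^ z ≤ n * (e * T' ^ z) := mul_le_mul_of_nonneg_left h2 hn0
      _ = e * (n * T' ^ z) := by ring
      _ ≤ e * (2 * R) := mul_le_mul_of_nonneg_left hnR he.le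
      _ = _ := by ring
  set D := 10 * e * A + 2 * (n * r ^ z) with hD
  have hDR : D ≤ 34 * e * R := by
    have := mul_le_mul_of_nonneg_left hAR (show 0 ≤ 10 * e by positivity)
    rw [hD]
    linarith
  have hmass' : ∀ a, ∑ i ∈ G with lab i = a, (1 : ℝ) = ∑ i ∈ G with lab i = a, w i := by
    intro a
    rw [hw, sum_rescale lab a fun h0 => ?_, Finset.sum_const, nsmul_eq_mul, mul_one]
    have h2 : (0 : ℝ) < (G.filter fun i => lab i = a).card := by
      exact_mod_cast Finset.card_pos.2 h0
    exact lt_of_lt_of_le (mul_pos (by linarith) h2) (hmass a).1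
  have hwG : ∀ i ∉ G, 1 = w i := fun i hi => by rw [hw, rescale, if_neg hi]
  have hfar : ∀ i ∈ G, ∀ j ∈ G, lab i = lab j → lab i ∉ N →
      centerDist (x i) C ^ z ≤ (1 + e) * centerDist (x j) C ^ z := by
    intro i hi j hj hij hiN
    have h1 := centerDist_le_add (x i) (x j) C
    have h2 := hdiam i hi j hj hij
    refine (pow_le_pow_left₀ (centerDist_nonneg _ _)
      (show _ ≤ centerDist (x j) C + Δ by linarith) z).trans ?_
    exact add_pow_le_of_le_mul hz (centerDist_nonneg _ _) hΔ (by linarith)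
      (hΔT.trans (mul_le_mul_of_nonneg_left (hfarT j hj (hij ▸ hiN)) he.le))
  have hnear : ∀ i ∈ G, ∀ j ∈ G, lab i = lab j → lab i ∈ N →
      centerDist (x i) C ^ z ≤ centerDist (x j) C ^ z + 2 * e * T' ^ z := by
    intro i hi j hj hij hiN
    have h1 := centerDist_le_add (x i) (x j) C
    have h2 := hdiam i hi j hj hij
    have h3 := hNle j hj (hij ▸ hiN)
    refine (pow_le_pow_add_of_le (e := e) (T := T' + Δ) hz (centerDist_nonneg _ _) hΔ h3
      (by linarith) ?_ (centerDist_nonneg _ _) (show _ ≤ centerDist (x j) C + Δ by linarith)).trans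
      ?_
    · refine hΔT.trans (mul_le_mul_of_nonneg_left (by linarith) he.le)
    · have := mul_le_mul_of_nonneg_left hTΔ he.le
      linarith
  have hb : 0 ≤ 2 * e * T' ^ z := by positivity
  have hbR : 2 * e * T' ^ z * h ≤ 2 * e * R := by
    have h1 := mul_le_mul_of_nonneg_left hhm hT'z
    have h2 : 2 * e * (T' ^ z * h) ≤ 2 * e * R :=
      mul_le_mul_of_nonneg_left (by linarith) (by positivity)
    linarith
  have heR := mul_nonneg he.le hR0
  -- The additive error is `36 * e * R`: 34 parts from `D` and 2 from moving outliers within near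
  -- pieces. The factor `1 + e` of the far pieces also fits into 40.
  constructor
  · have h1 := robustCost_le_of_mass_eq_on (G := G) (x := x) (C := C) (z := z) (u := w) (w := fun _ => 1)
      (D := D) hw0 (fun _ => zero_le_one) hh (show 1 ≤ 1 + e by linarith) hb lab N (fun i hi => (hwG i hi).symm)
      (fun a => (hmass' a).symm) hfar hnear (by
        simpa only [one_mul] using hN2)
    rw [← hRdef] at h1
    have h2 : (1 - 36 * e) * R ≤ (1 + e) * robustCost z h x w C := by linarith
    refine le_of_mul_le_mul_left ?_ (show 0 < 1 + e by linarith)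
    refine le_trans ?_ h2
    rw [← mul_assoc]
    exact mul_le_mul_of_nonneg_right (by nlinarith) hR0
  · have h1 := robustCost_le_of_mass_eq_on (G := G) (x := x) (C := C) (z := z) (u := fun _ => 1) (w := w)
      (D := D) (fun _ => zero_le_one) hw0 hh (show 1 ≤ 1 + e by linarith) hb lab N hwG
      hmass' hfar hnear (by
        simpa only [one_mul] using hN1)
    rw [← hRdef] at h1
    linarith

end Rescaled

/-! ### Oracle calls on a part of the dataset -/

section SubWeights

variable {n d k z : ℕ} {ε : ℝ} {N : ℕ → ℕ → ℝ → ℝ} {A : Construction} {G : Finset (Fin n)}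
  {y : Fin n → EuclideanSpace ℝ (Fin d)}

/-- The weights that the construction `A` assigns to the points `y i`, `i ∈ G`. -/
def subWeights (A : Construction) (d k : ℕ) (ε : ℝ) (G : Finset (Fin n))
    (y : Fin n → EuclideanSpace ℝ (Fin d)) (i : Fin n) : ℝ :=
  if h : i ∈ G then A d k ε G.card (fun t => y (G.equivFin.symm t)) (G.equivFin ⟨i, h⟩) else 0

theorem subWeights_equivFin_symm (t : Fin G.card) :
    subWeights A d k ε G y (G.equivFin.symm t) =
      A d k ε G.card (fun t => y (G.equivFin.symm t)) t := by
  rw [subWeights, dif_pos (G.equivFin.symm t).2]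
  simp

theorem sum_equivFin_symm (G : Finset (Fin n)) (f : Fin n → ℝ) :
    ∑ t, f (G.equivFin.symm t) = ∑ i ∈ G, f i := by
  rw [Equiv.sum_comp G.equivFin.symm fun i : G => f i, Finset.sum_coe_sort]

theorem subWeights_spec (hA : IsVanillaConstruction z N A) (hd : 1 ≤ d) (hk : 1 ≤ k) (hε : 0 < ε)
    (hε' : ε < 1) (hy : Set.InjOn y G) :
    (∀ i, 0 ≤ subWeights A d k ε G y i) ∧ Preserves k z ε G y (subWeights A d k ε G y) ∧
      (size (subWeights A d k ε G y) : ℝ) ≤ N d k ε⁻¹ := by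
  have hinj : Function.Injective fun t => y (G.equivFin.symm t) := fun s t hst =>
    G.equivFin.symm.injective (Subtype.ext
      (hy (G.equivFin.symm s).2 (G.equivFin.symm t).2 hst))
  obtain ⟨⟨h0, hcost⟩, hsize⟩ := hA d k ε hd hk hε hε' G.card _ hinj
  refine ⟨fun i => ?_, fun C => ?_, le_trans ?_ hsize⟩
  · rw [subWeights]
    split_ifs with hi
    · exact h0 _
    · exact le_rfl
  · have := hcost C 0 le_rfl (by simp)
    rw [robustCost_zero fun _ => zero_le_one, robustCost_zero h0, cost, cost] at this
    simp only [one_mul, ← subWeights_equivFin_symm] at this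
    rwa [sum_equivFin_symm G fun i => centerDist (y i) C ^ z,
      sum_equivFin_symm G fun i => subWeights A d k ε G y i * centerDist (y i) C ^ z] at this
  · rw [size, size, Nat.cast_le]
    refine (Set.ncard_le_ncard (t := (fun t => (G.equivFin.symm t : Fin n)) ''
      {t | A d k ε G.card (fun t => y (G.equivFin.symm t)) t ≠ 0}) ?_ (Set.toFinite _)).trans
      (Set.ncard_image_le (Set.toFinite _))
    intro i hi
    by_cases hiG : i ∈ G
    · refine ⟨G.equivFin ⟨i, hiG⟩, ?_, by simp⟩
      rw [Set.mem_ofPred_eq, subWeights, dif_pos hiG] at hi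
      exact hi
    · rw [Set.mem_ofPred_eq, subWeights, dif_neg hiG] at hi
      exact absurd rfl hi

theorem size_le_add_card_compl {v w : Fin n → ℝ} (h : ∀ i ∈ G, v i = 0 → w i = 0) :
    size w ≤ size v + Gᶜ.card := by
  rw [size, size, ← Set.ncard_coe_finset]
  refine (Set.ncard_le_ncard ?_ (Set.toFinite _)).trans (Set.ncard_union_le _ _)
  intro i hi
  by_cases hiG : i ∈ G
  · exact .inl fun hv => hi (h i hiG hv)
  · exact .inr (by simpa using hiG)

end SubWeights

/-! ### Lifting to a larger dimension -/

/-- The point `u` at height `a` in the `D`-dimensional space. -/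
def liftPoint {d : ℕ} (D : ℕ) (u : EuclideanSpace ℝ (Fin d)) (a : ℝ) : EuclideanSpace ℝ (Fin D) :=
  WithLp.toLp 2 fun t => if h : (t : ℕ) < d then u ⟨t, h⟩ else if (t : ℕ) = d then a else 0

/-- By Pythagoras, the lifted distance is a hypotenuse with legs `dist u v` and `|a - b|`. -/
theorem isLift_liftPoint {d D : ℕ} (hD : d + 1 ≤ D) : IsLift (liftPoint (d := d) D) := by
  have key : ∀ (u v : EuclideanSpace ℝ (Fin d)) (a b : ℝ),
      dist (liftPoint D u a) (liftPoint D v b) = √(dist u v ^ 2 + |a - b| ^ 2) := by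
    obtain ⟨r, rfl⟩ := Nat.exists_eq_add_of_le hD
    intro u v a b
    rw [EuclideanSpace.dist_eq, EuclideanSpace.dist_eq, Real.sq_sqrt (by positivity),
      Fin.sum_univ_add, Fin.sum_univ_castSucc]
    congr 1
    simp [liftPoint, Real.dist_eq]
    refine Finset.sum_eq_zero fun i _ => ?_
    have h1 : ¬ d + 1 + (i : ℕ) < d := by omega
    have h2 : ¬ d + 1 + (i : ℕ) = d := by omega
    simp [h1, h2]
  refine ⟨fun u v a b => ?_, fun u v a b => ?_, fun u v a b => ?_⟩ <;> rw [key]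
  · exact Real.le_sqrt_of_sq_le (by nlinarith [sq_nonneg |a - b|])
  · exact Real.le_sqrt_of_sq_le (by nlinarith [sq_nonneg (dist u v)])
  · have h1 := dist_nonneg (x := u) (y := v)
    have h2 := abs_nonneg (a - b)
    exact Real.sqrt_le_iff.2 ⟨by positivity, by nlinarith [mul_nonneg h1 h2]⟩

/-! ### Size bounds -/

/-- Serves to absorb `K ^ z` into `c * z ^ (c * z)`. For `z = 1` the factor `K` does it; for `z ≥ 2`
one has `K ≤ 2 ^ 19 ≤ z ^ 19`. -/
theorem pow_le_mul_pow {z : ℕ} {K : ℝ} (hz : 1 ≤ z) (hK : 1 ≤ K) (hK' : K ≤ 2 ^ 19) :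
    K ^ z ≤ K * (z : ℝ) ^ (19 * z) := by
  rcases hz.eq_or_lt with rfl | hz
  · simp
  · have h2 : (2 : ℝ) ≤ z := by exact_mod_cast hz
    have h1 : K ^ z ≤ (z : ℝ) ^ (19 * z) := by
      rw [pow_mul]
      exact pow_le_pow_left₀ (by linarith) (hK'.trans (pow_le_pow_left₀ (by norm_num) h2 _)) _
    exact h1.trans (le_mul_of_one_le_left (by positivity) hK)

theorem one_le_logTerm (k m : ℕ) (ε : ℝ) : 1 ≤ logTerm k m ε := le_max_left _ _

/-- The base-2 logarithm costs a factor below 2, as `log 2 > 1 / 2`, and the summand 1 is at most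
`logTerm`. -/
theorem log_two_add_one_le_logTerm {k m : ℕ} {ε : ℝ} (hk : 1 ≤ k) (hm : 1 ≤ m) (hε : 0 < ε)
    (hε' : ε < 1) : ((Nat.log 2 k + 1 : ℕ) : ℝ) ≤ 3 * logTerm k m ε := by
  have hk' : (1 : ℝ) ≤ k := by exact_mod_cast hk
  have hm' : (1 : ℝ) ≤ m := by exact_mod_cast hm
  have h1 : Real.log k ≤ logTerm k m ε := by
    refine le_trans (Real.log_le_log (by linarith) ?_) (le_max_right _ _)
    have := (one_le_inv₀ hε).2 hε'.le
    have h : (1 : ℝ) ≤ m * ε⁻¹ := one_le_mul_of_one_le_of_one_le hm' this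
    rw [mul_assoc]
    exact le_mul_of_one_le_right (by linarith) h
  have h2 : (Nat.log 2 k : ℝ) * Real.log 2 ≤ Real.log k := by
    rw [← Real.log_pow]
    refine Real.log_le_log (by positivity) ?_
    exact_mod_cast Nat.pow_log_le_self 2 (by omega)
  have h3 := Real.log_two_gt_d9
  have h4 : (0 : ℝ) ≤ Nat.log 2 k := by positivity
  have h5 := one_le_logTerm k m ε
  push_cast
  nlinarith

/-! ### The two constructions -/

section Constructions

variable {n d k z m : ℕ} {ε : ℝ} {N : ℕ → ℕ → ℝ → ℝ} {A : Construction}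
  {x : Fin n → EuclideanSpace ℝ (Fin d)}
  {b : (Fin k → Fin n) × (Fin n → Fin k) × Finset (Fin n)}

/-- The points of `b` that are not outliers and whose connection cost is at most `ρ` times the
total cost. -/
def IsCore (z : ℕ) (ρ : ℝ) (x : Fin n → EuclideanSpace ℝ (Fin d))
    (b : (Fin k → Fin n) × (Fin n → Fin k) × Finset (Fin n)) (i : Fin n) : Prop :=
  i ∉ b.2.2 ∧ dist (x i) (x (b.1 (b.2.1 i))) ^ z ≤ ρ * assignCost z x b

theorem card_compl_core_le {G : Finset (Fin n)} {ρ : ℝ} (hρ : 0 < ρ) (hb : b.2.2.card ≤ m)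
    (hG : ∀ i, i ∈ G ↔ IsCore z ρ x b i) : (Gᶜ.card : ℝ) ≤ m + ρ⁻¹ := by
  have h1 : Gᶜ ⊆ b.2.2 ∪ b.2.2ᶜ.filter fun i =>
      ρ * assignCost z x b < dist (x i) (x (b.1 (b.2.1 i))) ^ z := by
    intro i hi
    rw [Finset.mem_compl, hG, IsCore, not_and, not_le] at hi
    by_cases h : i ∈ b.2.2
    · exact Finset.mem_union_left _ h
    · exact Finset.mem_union_right _ (Finset.mem_filter.2 ⟨Finset.mem_compl.2 h, hi h⟩)
  have h2 := (Finset.card_le_card h1).trans (Finset.card_union_le _ _)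
  have h3 := card_filter_lt_le (z := z) x b hρ
  have h4 : (Gᶜ.card : ℝ) ≤ b.2.2.card + ((b.2.2ᶜ.filter fun i =>
      ρ * assignCost z x b < dist (x i) (x (b.1 (b.2.1 i))) ^ z).card : ℝ) := by exact_mod_cast h2
  have h5 : (b.2.2.card : ℝ) ≤ m := by exact_mod_cast hb
  linarith

/-- The points of `G` in clusters with at least `s₀` points. -/
def largeClusters (s₀ : ℝ) (q : Fin n → Fin k) (G : Finset (Fin n)) : Finset (Fin n) :=
  open Classical in G.filter fun i => s₀ ≤ ((G.filter fun j => q j = q i).card : ℝ)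

/-- Clusters survive or disappear as a whole, so the surviving ones keep their size. -/
theorem le_card_largeClusters {s₀ : ℝ} {q : Fin n → Fin k} {G : Finset (Fin n)} :
    ∀ i ∈ largeClusters s₀ q G,
      s₀ ≤ (((largeClusters s₀ q G).filter fun j => q j = q i).card : ℝ) := by
  intro i hi
  have hi' := (Finset.mem_filter.1 hi).2
  have : (largeClusters s₀ q G).filter (fun j => q j = q i) = G.filter fun j => q j = q i := by
    rw [largeClusters, Finset.filter_filter]
    refine Finset.filter_congr fun j _ => ⟨fun h => h.2, fun h => ⟨?_, h⟩⟩
    rwa [h]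
  rwa [this]

theorem card_compl_largeClusters_le {s₀ : ℝ} (hs₀ : 0 ≤ s₀) {q : Fin n → Fin k}
    {G : Finset (Fin n)} :
    ((largeClusters s₀ q G)ᶜ.card : ℝ) ≤ Gᶜ.card + k * s₀ := by
  classical
  have h1 : (largeClusters s₀ q G)ᶜ ⊆ Gᶜ ∪ G \ largeClusters s₀ q G := by
    intro i hi
    by_cases h : i ∈ G
    · exact Finset.mem_union_right _ (Finset.mem_sdiff.2 ⟨h, Finset.mem_compl.1 hi⟩)
    · exact Finset.mem_union_left _ (Finset.mem_compl.2 h)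
  have h2 := (Finset.card_le_card h1).trans (Finset.card_union_le _ _)
  have h3 : ((G \ largeClusters s₀ q G).card : ℝ) ≤ k * s₀ := by
    have h4 : ((G \ largeClusters s₀ q G).card : ℝ) = ∑ a : Fin k,
        (((G \ largeClusters s₀ q G).filter fun i => q i = a).card : ℝ) := by
      exact_mod_cast Finset.card_eq_sum_card_fiberwise (t := Finset.univ)
        fun _ _ => Finset.mem_coe.2 (Finset.mem_univ _)
    have h5 : ∑ a : Fin k, (((G \ largeClusters s₀ q G).filter fun i => q i = a).card : ℝ) ≤
        ∑ _a : Fin k, s₀ := by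
      refine Finset.sum_le_sum fun a _ => ?_
      rcases ((G \ largeClusters s₀ q G).filter fun i => q i = a).eq_empty_or_nonempty with h | h
      · simp [h, hs₀]
      · obtain ⟨i, hi⟩ := h
        obtain ⟨hi', rfl⟩ := Finset.mem_filter.1 hi
        obtain ⟨hiG, hiL⟩ := Finset.mem_sdiff.1 hi'
        have hlt : ((G.filter fun j => q j = q i).card : ℝ) < s₀ := by
          by_contra! hcon
          exact hiL (Finset.mem_filter.2 ⟨hiG, hcon⟩)
        refine le_trans ?_ hlt.le
        exact_mod_cast Finset.card_le_card
          (Finset.filter_subset_filter _ Finset.sdiff_subset)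
    rw [h4]
    simpa using h5
  have h6 : ((largeClusters s₀ q G)ᶜ.card : ℝ) ≤ Gᶜ.card + (G \ largeClusters s₀ q G).card := by
    exact_mod_cast h2
  linarith

/-- The weights `v` on `G`, and weight `1` outside `G`. -/
def extendByOne (G : Finset (Fin n)) (v : Fin n → ℝ) (i : Fin n) : ℝ :=
  if i ∈ G then v i else 1

/-- The cluster threshold `s₀` gives `m * 3 ^ z / s₀ = ε / 10`, and the core threshold `ρ` gives `m
* 3 ^ z * 2 * ρ * V = (ε / 10) * V / 2 ^ z`. At most `m + 20 * 6 ^ z * m / ε + 10 * 3 ^ z * k * m /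
ε` points are kept. -/
theorem isCoreset_of_largeClusters {c : ℕ} (hc : c = 10 ^ 6) (hd : 1 ≤ d) (hk : 1 ≤ k)
    (hz : 1 ≤ z) (hm : 1 ≤ m) (hε : 0 < ε) (hε' : ε < 1) [Nonempty (Fin n)]
    (hA : IsVanillaConstruction z N A)
    (hx : Function.Injective x) (hb : IsOptimal z m x b) {G G₁ : Finset (Fin n)}
    (hG : ∀ i, i ∈ G ↔ IsCore z (ε / (20 * 6 ^ z * m)) x b i)
    (hG₁ : G₁ = largeClusters (10 * 3 ^ z * m / ε) b.2.1 G) :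
    IsCoreset k z m ε x (extendByOne G₁ (subWeights A d k (ε / c) G₁ x)) ∧
      (size (extendByOne G₁ (subWeights A d k (ε / c) G₁ x)) : ℝ) ≤
        sizeBound₁ c N d k z m ε := by
  have hcR : (c : ℝ) = 10 ^ 6 := by rw [hc]; norm_num
  have hm' : (1 : ℝ) ≤ m := by exact_mod_cast hm
  have hk' : (1 : ℝ) ≤ k := by exact_mod_cast hk
  have hz' : (1 : ℝ) ≤ z := by exact_mod_cast hz
  obtain ⟨hv0, hP, hsize⟩ := subWeights_spec (k := k) (G := G₁) (y := x) hA hd hk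
    (show 0 < ε / c by rw [hcR]; positivity)
    (show ε / c < 1 by rw [hcR, div_lt_one (by norm_num)]; linarith) hx.injOn
  have hG₁G : G₁ ⊆ G := hG₁ ▸ Finset.filter_subset _ _
  set v := subWeights A d k (ε / c) G₁ x
  have hP' : Preserves k z (ε / 10) G₁ x v := hP.mono (by
    rw [hcR]
    exact div_le_div_of_nonneg_left hε.le (by norm_num) (by norm_num))
  set w := extendByOne G₁ v with hw
  have hw0 : ∀ i, 0 ≤ w i := fun i => by
    rw [hw, extendByOne]
    split_ifs
    exacts [hv0 i, zero_le_one]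
  have hV := assignCost_nonneg (z := z) x b
  have hρ : 0 < ε / (20 * 6 ^ z * m) := by positivity
  refine ⟨⟨hw0, fun C h hh hhm => ?_⟩, ?_⟩
  · have hwG : ∑ i ∈ G₁, w i * centerDist (x i) C ^ z = ∑ i ∈ G₁, v i * centerDist (x i) C ^ z :=
      Finset.sum_congr rfl fun i hi => by rw [hw, extendByOne, if_pos hi]
    have := robustCost_approx_of_large_clusters (x := x) (C := C) (z := z) (w := w) (G := G₁)
      (h := h) (η := ε / 10) (U := assignCost z x b / 2 ^ z) (a := 3 ^ z)
      (b := 3 ^ z * (2 * (ε / (20 * 6 ^ z * m) * assignCost z x b)))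
      (s₀ := 10 * 3 ^ z * m / ε) b.2.1 hw0 (fun i hi => by rw [hw, extendByOne, if_neg hi]) hh
      (by positivity) (by positivity) (by positivity) (by positivity) (by linarith)
      (by rw [hG₁]; exact le_card_largeClusters) ?_ ?_ ?_ ?_ ?_ ?_
    · rwa [show 10 * (ε / 10) = ε by ring] at this
    · intro i hi j hj hij
      have h1 := ((hG i).1 (hG₁G hi)).2
      have h2 := ((hG j).1 (hG₁G hj)).2
      have h3 := centerDist_le_add (x i) (x j) C
      have h4 := dist_triangle_right (x i) (x j) (x (b.1 (b.2.1 i)))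
      rw [hij] at h2
      refine (pow_le_pow_left₀ (centerDist_nonneg _ _) (show _ ≤ centerDist (x j) C +
        dist (x i) (x (b.1 (b.2.1 i))) + dist (x j) (x (b.1 (b.2.1 i))) by linarith) z).trans
        ((add_add_pow_le z (centerDist_nonneg _ _) dist_nonneg dist_nonneg).trans ?_)
      rw [← mul_add]
      refine mul_le_mul_of_nonneg_left (by linarith) (by positivity)
    · rw [div_le_iff₀' (by positivity)]
      exact hb.le_robustCost hk C hh hhm
    · refine (mul_le_mul_of_nonneg_right hhm (by positivity)).trans (le_of_eq ?_)
      field_simp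
    · refine (mul_le_mul_of_nonneg_right hhm (by positivity)).trans (le_of_eq ?_)
      rw [show (6 : ℝ) = 2 * 3 by norm_num, mul_pow]
      field_simp
      ring
    · rw [hwG]
      exact (hP' C).1
    · rw [hwG]
      exact (hP' C).2
  · have h1 : size w ≤ size v + G₁ᶜ.card := size_le_add_card_compl fun i hi hvi => by
      rw [hw, extendByOne, if_pos hi, hvi]
    have h2 : (size w : ℝ) ≤ size v + G₁ᶜ.card := by exact_mod_cast h1
    have h3 := card_compl_core_le hρ hb.1 hG
    have h4 := card_compl_largeClusters_le (k := k) (q := b.2.1) (G := G)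
      (show 0 ≤ 10 * 3 ^ z * m / ε by positivity)
    rw [← hG₁] at h4
    rw [inv_div] at h3 hsize
    rw [sizeBound₁, ← div_eq_mul_inv]
    have h36 : (3 : ℝ) ^ z ≤ 6 ^ z := pow_le_pow_left₀ (by norm_num) (by norm_num) z
    have h16 : (1 : ℝ) ≤ 6 ^ z := one_le_pow₀ (by norm_num)
    have hX : 0 < (k : ℝ) * m / ε := by positivity
    have e1 : (m : ℝ) ≤ 6 ^ z * (k * m / ε) := by
      have h5 : (m : ℝ) ≤ k * m / ε := by
        rw [le_div_iff₀ hε]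
        nlinarith
      nlinarith
    have e2 : 20 * 6 ^ z * m / ε ≤ 20 * (6 ^ z * (k * m / ε)) := by
      rw [show 20 * 6 ^ z * (m : ℝ) / ε = 20 * (6 ^ z * (m / ε)) by ring,
        show (k : ℝ) * m / ε = k * (m / ε) by ring]
      refine mul_le_mul_of_nonneg_left (mul_le_mul_of_nonneg_left ?_ (by positivity)) (by norm_num)
      exact le_mul_of_one_le_left (by positivity) hk'
    have e3 : (k : ℝ) * (10 * 3 ^ z * m / ε) ≤ 10 * (6 ^ z * (k * m / ε)) := by
      rw [show (k : ℝ) * (10 * 3 ^ z * m / ε) = 10 * (3 ^ z * (k * m / ε)) by ring]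
      refine mul_le_mul_of_nonneg_left (mul_le_mul_of_nonneg_right h36 hX.le) (by norm_num)
    have h7 : 31 * (6 : ℝ) ^ z ≤ c * (z : ℝ) ^ (c * z) := by
      have h8 := pow_le_mul_pow (K := 6) hz (by norm_num) (by norm_num)
      have h9 : (z : ℝ) ^ (19 * z) ≤ (z : ℝ) ^ (c * z) :=
        pow_le_pow_right₀ hz' (Nat.mul_le_mul_right z (by rw [hc]; norm_num))
      have h10 : (0 : ℝ) ≤ (z : ℝ) ^ (c * z) := by positivity
      calc 31 * (6 : ℝ) ^ z ≤ 186 * (z : ℝ) ^ (19 * z) := by linarith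
        _ ≤ 186 * (z : ℝ) ^ (c * z) := by linarith
        _ ≤ c * (z : ℝ) ^ (c * z) := mul_le_mul_of_nonneg_right (by rw [hcR]; norm_num) h10
    have h11 := mul_le_mul_of_nonneg_right h7 hX.le
    rw [← div_eq_mul_inv]
    linarith

/-- The parameter `p` (the number of colors) of the sparse partition. -/
def numColors (k : ℕ) : ℕ := Nat.log 2 k + 1

/-- The factor by which the scale of the outliers exceeds the radius of the clusters. -/
def scaleRatio (k z : ℕ) (ε : ℝ) : ℝ := 96 * z ^ 2 * numColors k / (ε / 40) ^ 2

/-- The separation of pieces of the same color, in terms of the radius of the clusters. -/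
def separation (z : ℕ) (ε : ℝ) : ℝ := 2 * (4 * z / (ε / 40) + 1)

/-- The threshold for the connection cost of the clusters. -/
def coreRatio (k z m : ℕ) (ε : ℝ) : ℝ := (m * scaleRatio k z ε ^ z)⁻¹

/-- `π` and `col` describe a sparse partition of the centers of `b`. -/
def IsSparse (m z : ℕ) (ε : ℝ) (x : Fin n → EuclideanSpace ℝ (Fin d))
    (b : (Fin k → Fin n) × (Fin n → Fin k) × Finset (Fin n)) (π : Fin k → Fin k)
    (col : Fin k → Fin (numColors k)) : Prop :=
  (∀ Q, dist (x (b.1 Q)) (x (b.1 (π Q))) ^ z ≤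
      (numColors k * separation z ε) ^ z * coreRatio k z m ε * assignCost z x b) ∧
    ∀ Q Q', col Q = col Q' → dist (x (b.1 Q)) (x (b.1 Q')) ^ z ≤
      separation z ε ^ z * coreRatio k z m ε * assignCost z x b → π Q = π Q'

/-- The distance between consecutive pieces in the lifted dataset. -/
def liftHeight (z : ℕ) (ε : ℝ) (x : Fin n → EuclideanSpace ℝ (Fin d)) : ℝ :=
  (2 * z + 2 * n) / (ε / 40) * (1 + ∑ i, ∑ j, dist (x i) (x j))

/-- The lifted dataset. -/
def liftedPoints (D z : ℕ) (ε : ℝ) (x : Fin n → EuclideanSpace ℝ (Fin d))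
    (lab : Fin n → Fin k) (i : Fin n) : EuclideanSpace ℝ (Fin D) :=
  liftPoint D (x i) (liftHeight z ε x * (lab i : ℕ))

theorem scaleRatio_pos (hz : 1 ≤ z) (hε : 0 < ε) : 0 < scaleRatio k z ε := by
  have hz' : (1 : ℝ) ≤ z := by exact_mod_cast hz
  rw [scaleRatio, numColors]
  push_cast
  positivity

/-- The radius of the clusters. -/
theorem exists_radius (hz : 1 ≤ z) (hm : 1 ≤ m) (hε : 0 < ε)
    (x : Fin n → EuclideanSpace ℝ (Fin d))
    (b : (Fin k → Fin n) × (Fin n → Fin k) × Finset (Fin n)) :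
    ∃ T' r : ℝ, 0 ≤ T' ∧ 0 ≤ r ∧ m * T' ^ z = assignCost z x b / 2 ^ z ∧
      r ^ z = coreRatio k z m ε * assignCost z x b ∧ T' = scaleRatio k z ε / 2 * r := by
  have hV := assignCost_nonneg (z := z) x b
  have hB := scaleRatio_pos (k := k) hz hε
  have hm' : (1 : ℝ) ≤ m := by exact_mod_cast hm
  have hT0 : 0 ≤ assignCost z x b / 2 ^ z / m := by positivity
  set T' : ℝ := (assignCost z x b / 2 ^ z / m) ^ ((z : ℝ)⁻¹) with hT'
  have hT'z : T' ^ z = assignCost z x b / 2 ^ z / m :=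
    Real.rpow_inv_natCast_pow hT0 (by omega)
  have hT'0 : 0 ≤ T' := Real.rpow_nonneg hT0 _
  refine ⟨T', 2 * T' / scaleRatio k z ε, hT'0, by positivity, ?_, ?_, ?_⟩
  · rw [hT'z]
    field_simp
  · rw [div_pow, mul_pow, hT'z, coreRatio]
    field_simp
  · field_simp

/-- `IsSparse` speaks of `z`-th powers because a tree has only square roots; the radius `r` is used
in the analysis and never computed. -/
theorem exists_isSparse (hz : 1 ≤ z) (hm : 1 ≤ m) (hε : 0 < ε)
    (x : Fin n → EuclideanSpace ℝ (Fin d))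
    (b : (Fin k → Fin n) × (Fin n → Fin k) × Finset (Fin n)) :
    ∃ π col, IsSparse m z ε x b π col := by
  obtain ⟨T', r, -, hr, -, hrz, -⟩ := exists_radius (k := k) hz hm hε x b
  have hs : 0 ≤ separation z ε := by
    rw [separation]
    positivity
  obtain ⟨π, col, h1, h2⟩ := exists_sparse_partition (fun Q => x (b.1 Q))
    (mul_nonneg hs hr) (numColors k) (by
      rw [Fintype.card_fin]
      exact Nat.lt_pow_succ_log_self (by norm_num) k)
  refine ⟨π, col, fun Q => ?_, fun Q Q' hQ hd => h2 Q Q' hQ ?_⟩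
  · rw [mul_assoc, ← hrz, ← mul_pow]
    refine pow_le_pow_left₀ dist_nonneg ((h1 Q).trans (le_of_eq ?_)) z
    ring
  · rw [mul_assoc, ← hrz, ← mul_pow] at hd
    exact (pow_le_pow_iff_left₀ dist_nonneg (mul_nonneg hs hr) (by omega)).1 hd

/-- With `e = ε / 40`, `T = 4 * z / e * r` and `p = numColors k`, pieces have diameter at most `Δ =
6 * p * T`, and `scaleRatio` is chosen so that `2 * z * Δ = e * T'`. At most `m + m * scaleRatio ^
z` points are kept, whence the term `m ε^{-2z} L^z`. -/
theorem isCoreset_of_isSparse {c k' : ℕ} (hc : c = 10 ^ 6)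
    (hk' : k' = ⌈(c : ℝ) * k * logTerm k m ε ^ 2⌉₊) (hd : 1 ≤ d) (hk : 1 ≤ k)
    (hz : 1 ≤ z) (hm : 1 ≤ m) (hε : 0 < ε) (hε' : ε < 1) [Nonempty (Fin n)]
    (hA : IsVanillaConstruction z N A)
    (hx : Function.Injective x) (hb : IsOptimal z m x b) {G : Finset (Fin n)}
    (hG : ∀ i, i ∈ G ↔ IsCore z (coreRatio k z m ε) x b i) {π : Fin k → Fin k}
    {col : Fin k → Fin (numColors k)} (hπ : IsSparse m z ε x b π col)
    {lab : Fin n → Fin k} (hlab : ∀ i, lab i = π (b.2.1 i)) :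
    IsCoreset k z m ε x (rescale G lab
        (subWeights A (c * d) k' (ε / c) G (liftedPoints (c * d) z ε x lab))) ∧
      (size (rescale G lab
        (subWeights A (c * d) k' (ε / c) G (liftedPoints (c * d) z ε x lab))) : ℝ) ≤
        sizeBound₂ c N d k z m ε := by
  obtain rfl : lab = fun i => π (b.2.1 i) := funext hlab
  have hcR : (c : ℝ) = 10 ^ 6 := by rw [hc]; norm_num
  have hm' : (1 : ℝ) ≤ m := by exact_mod_cast hm
  have hkR : (1 : ℝ) ≤ k := by exact_mod_cast hk
  have hz' : (1 : ℝ) ≤ z := by exact_mod_cast hz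
  have hn' : (1 : ℝ) ≤ n := by
    exact_mod_cast Fin.pos_iff_nonempty.2 ‹_›
  have hL := one_le_logTerm k m ε
  have hpL : (numColors k : ℝ) ≤ 3 * logTerm k m ε :=
    log_two_add_one_le_logTerm hk hm hε hε'
  have hp1 : (1 : ℝ) ≤ numColors k := by
    rw [numColors]
    push_cast
    linarith [show (0 : ℝ) ≤ Nat.log 2 k by positivity]
  have hcd : d + 1 ≤ c * d := by
    rw [hc]
    omega
  have hkk' : k * numColors k + k ≤ k' := by
    have h1 : (c : ℝ) * k * logTerm k m ε ^ 2 ≤ k' := hk' ▸ Nat.le_ceil _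
    have h2 : (k : ℝ) * numColors k + k ≤ c * k * logTerm k m ε ^ 2 := by
      rw [hcR]
      have h3 : (numColors k : ℝ) + 1 ≤ 10 ^ 6 * logTerm k m ε ^ 2 := by nlinarith
      have := mul_le_mul_of_nonneg_left h3 (show (0 : ℝ) ≤ k by linarith)
      linarith
    exact_mod_cast h2.trans h1
  have hkk'' : k + 1 ≤ k' := by
    refine le_trans ?_ hkk'
    have : 1 ≤ numColors k := by rw [numColors]; omega
    nlinarith
  have hk'1 : 1 ≤ k' := by omega
  have hlift := isLift_liftPoint hcd
  have hM1 : 1 ≤ 1 + ∑ i, ∑ j, dist (x i) (x j) :=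
    le_add_of_nonneg_right (Finset.sum_nonneg fun i _ => Finset.sum_nonneg fun j _ => dist_nonneg)
  have hMdist : ∀ i j, dist (x i) (x j) ≤ 1 + ∑ i, ∑ j, dist (x i) (x j) := by
    intro i j
    have h1 : dist (x i) (x j) ≤ ∑ j, dist (x i) (x j) :=
      Finset.single_le_sum (fun j _ => dist_nonneg) (Finset.mem_univ j)
    have h2 : ∑ j, dist (x i) (x j) ≤ ∑ i, ∑ j, dist (x i) (x j) :=
      Finset.single_le_sum (f := fun i => ∑ j, dist (x i) (x j))
        (fun i _ => Finset.sum_nonneg fun j _ => dist_nonneg) (Finset.mem_univ i)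
    linarith
  obtain ⟨H, hH⟩ : ∃ H, H = liftHeight z ε x := ⟨_, rfl⟩
  obtain ⟨M, hM⟩ : ∃ M, M = 1 + ∑ i, ∑ j, dist (x i) (x j) := ⟨_, rfl⟩
  -- The summand `2 * z` serves `2 * z * M ≤ e * H`, and `2 * n` serves `2 * G.card * M ^ z ≤ e * H
  -- ^ z`. The 1 in `M` keeps `H` positive for a single point.
  have hHM : H = (2 * z + 2 * n) / (ε / 40) * M := by rw [hH, hM, liftHeight]
  rw [← hM] at hM1 hMdist
  have hM0 : 0 ≤ M := by linarith
  have hHpos : 0 < H := by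
    rw [hHM]
    positivity
  obtain ⟨e, he⟩ : ∃ e, e = ε / 40 := ⟨_, rfl⟩
  have he0 : 0 < e := by rw [he]; positivity
  have he1 : e ≤ 1 / 40 := by rw [he]; linarith
  have heH : e * H = (2 * z + 2 * n) * M := by
    rw [hHM, ← he]
    field_simp
  have hyinj : Set.InjOn (liftedPoints (c * d) z ε x fun i => π (b.2.1 i)) G := by
    intro i _ j _ hij
    have h1 := hlift.dist_le_dist (x i) (x j) (liftHeight z ε x * (π (b.2.1 i) : ℕ))
      (liftHeight z ε x * (π (b.2.1 j) : ℕ))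
    exact hx (dist_le_zero.1 (h1.trans (dist_eq_zero.2 hij).le))
  obtain ⟨hv0, hP, hsize⟩ := subWeights_spec (d := c * d) (k := k') (G := G) hA (by omega) hk'1
    (show 0 < ε / c by rw [hcR]; positivity)
    (show ε / c < 1 by rw [hcR, div_lt_one (by norm_num)]; linarith) hyinj
  set v := subWeights A (c * d) k' (ε / c) G (liftedPoints (c * d) z ε x fun i => π (b.2.1 i))
  have hP' : Preserves k' z e G
      (fun i => liftPoint (c * d) (x i) (H * (π (b.2.1 i) : ℕ))) v := by
    rw [hH]
    refine hP.mono ?_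
    rw [hcR, he]
    exact div_le_div_of_nonneg_left hε.le (by norm_num) (by norm_num)
  have hV := assignCost_nonneg (z := z) x b
  have hB := scaleRatio_pos (k := k) hz hε
  obtain ⟨T', r, hT'0, hr, hT'z, hrz, hT'r⟩ := exists_radius (k := k) hz hm hε x b
  have hsep : 0 ≤ separation z ε * r := by
    rw [separation]
    positivity
  have hradius : ∀ Q, dist (x (b.1 Q)) (x (b.1 (π Q))) ≤ numColors k * (separation z ε * r) := by
    intro Q
    have h1 := hπ.1 Q
    rw [mul_assoc, ← hrz, ← mul_pow] at h1
    rw [← mul_assoc]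
    exact (pow_le_pow_iff_left₀ dist_nonneg (by rw [mul_assoc]; positivity) (by omega)).1 h1
  refine ⟨⟨rescale_nonneg _ fun i _ => hv0 i, fun C h hh hhm => ?_⟩, ?_⟩
  · have hrad : ∀ i ∈ G, dist (x i) (x (b.1 (b.2.1 i))) ≤ r := by
      intro i hi
      have h1 := ((hG i).1 hi).2
      rw [← hrz] at h1
      exact (pow_le_pow_iff_left₀ dist_nonneg hr (by omega)).1 h1
    have hsepr : separation z ε * r = 2 * (4 * z / e * r + r) := by
      rw [separation, ← he]
      ring
    have hrT : r ≤ 4 * z / e * r / 4 := by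
      have : 1 ≤ z / e := by
        rw [le_div_iff₀ he0]
        linarith
      have := mul_le_mul_of_nonneg_right this hr
      rw [show 4 * z / e * r / 4 = z / e * r by ring]
      linarith
    have hΔT : 2 * z * (6 * numColors k * (4 * z / e * r)) = e * T' := by
      rw [hT'r, scaleRatio, ← he]
      field_simp
      ring
    have hT0 : 0 ≤ 4 * z / e * r := by positivity
    set T := 4 * z / e * r with hT
    have hTp : T ≤ numColors k * T := le_mul_of_one_le_left hT0 hp1
    -- Needed for `T' + Δ ≤ H`: each of at most `n` summands of `V` is at most `M ^ z`.
    have hTM : T' ≤ n * M := by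
      refine (pow_le_pow_iff_left₀ hT'0 (by positivity) (show z ≠ 0 by omega)).1 ?_
      have h1 : T' ^ z ≤ assignCost z x b := by
        have h2 : T' ^ z ≤ m * T' ^ z := le_mul_of_one_le_left (by positivity) hm'
        exact h2.trans (hT'z.trans_le (div_le_self hV (one_le_pow₀ (by norm_num))))
      refine h1.trans ?_
      have h3 : assignCost z x b ≤ ∑ i ∈ b.2.2ᶜ, M ^ z :=
        Finset.sum_le_sum fun i _ => pow_le_pow_left₀ dist_nonneg (hMdist _ _) z
      rw [Finset.sum_const, nsmul_eq_mul] at h3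
      refine h3.trans ?_
      rw [mul_pow]
      refine mul_le_mul_of_nonneg_right ?_ (by positivity)
      have h4 : ((b.2.2ᶜ).card : ℝ) ≤ n := by
        exact_mod_cast (Finset.card_le_univ _).trans_eq (Fintype.card_fin n)
      exact h4.trans (le_self_pow₀ hn' (by omega))
    have hΔ0 : 0 ≤ 6 * numColors k * T := by positivity
    have hΔT' : 6 * numColors k * T ≤ T' := by
      have h1 : 6 * numColors k * T ≤ 2 * z * (6 * numColors k * T) :=
        le_mul_of_one_le_left hΔ0 (by linarith)
      rw [hΔT] at h1
      exact h1.trans (mul_le_of_le_one_left hT'0 (by linarith))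
    have := robustCost_approx_of_lifted (C := C) (h := h) (M := M) (T := T) (T' := T')
      (Δ := 6 * numColors k * T) (U := assignCost z x b / 2 ^ z) (col := col) (π := π)
      (ctr := fun Q => x (b.1 Q)) hlift hz hk hm hkk' hkk'' (fun i _ => hv0 i) hP' he0 he1 hHpos
      hr hT'0 hΔ0 hM0 (fun i _ a => hMdist _ _) ?_ ?_ hrad ?_ ?_ ?_ hΔT.le ?_ ?_ hT'z.le ?_ hh hhm
    · rwa [show 40 * e = ε by rw [he]; ring] at this
    · rw [heH]
      exact mul_le_mul_of_nonneg_right (by linarith) hM0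
    · have h1 : (G.card : ℝ) ≤ n := by
        exact_mod_cast (Finset.card_le_univ _).trans_eq (Fintype.card_fin n)
      have h2 : 2 * n / e ≤ ((2 * z + 2 * n) / e) ^ z := by
        have h3 : 2 * n / e ≤ (2 * z + 2 * n) / e :=
          div_le_div_of_nonneg_right (by linarith) he0.le
        refine h3.trans (le_self_pow₀ ?_ (by omega))
        rw [le_div_iff₀ he0]
        linarith
      rw [hHM, ← he, mul_pow, ← mul_assoc]
      refine mul_le_mul_of_nonneg_right ?_ (by positivity)
      rw [div_le_iff₀' he0] at h2
      linarith
    · rw [hT]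
      refine le_of_eq ?_
      field_simp
      ring
    · intro Q Q' hQ hdist
      refine hπ.2 Q Q' hQ ?_
      rw [mul_assoc, ← hrz, ← mul_pow]
      refine pow_le_pow_left₀ dist_nonneg ?_ z
      rw [hsepr]
      exact hdist
    · intro i hi j hj hij
      have h1 := hrad i hi
      have h2 := hrad j hj
      have h3 := hradius (b.2.1 i)
      have h4 := hradius (b.2.1 j)
      rw [hij] at h3
      rw [hsepr] at h3 h4
      have h5 := dist_triangle4 (x i) (x (b.1 (b.2.1 i))) (x (b.1 (b.2.1 j))) (x j)
      have h6 := dist_triangle_right (x (b.1 (b.2.1 i))) (x (b.1 (b.2.1 j)))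
        (x (b.1 (π (b.2.1 j))))
      rw [dist_comm (x (b.1 (b.2.1 j))) (x j)] at h5
      have h7 : numColors k * r ≤ numColors k * (T / 4) :=
        mul_le_mul_of_nonneg_left hrT (by linarith)
      linarith
    · linarith
    · have h1 : (n : ℝ) * M * 2 ≤ H := by
        have h2 : e * H ≤ H := mul_le_of_le_one_left hHpos.le (by linarith)
        have h3 : 0 ≤ z * M := by positivity
        linarith
      linarith
    · rw [div_le_iff₀' (by positivity)]
      exact hb.le_robustCost hk C hh hhm
  · have h1 : size (rescale G (fun i => π (b.2.1 i)) v) ≤ size v + Gᶜ.card :=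
      size_le_add_card_compl fun i hi hvi => by rw [rescale, if_pos hi, hvi, zero_mul]
    have h2 : (size (rescale G (fun i => π (b.2.1 i)) v) : ℝ) ≤ size v + Gᶜ.card := by
      exact_mod_cast h1
    have h3 := card_compl_core_le (ρ := coreRatio k z m ε) (by rw [coreRatio]; positivity) hb.1 hG
    rw [coreRatio, inv_inv] at h3
    rw [inv_div] at hsize
    rw [sizeBound₂, ← hk', ← div_eq_mul_inv]
    have hL0 : 0 ≤ logTerm k m ε := by linarith
    have h4 : scaleRatio k z ε ≤ 460800 * z ^ 2 * ε⁻¹ ^ 2 * logTerm k m ε := by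
      have h5 : scaleRatio k z ε = 153600 * (z : ℝ) ^ 2 * ε⁻¹ ^ 2 * numColors k := by
        rw [scaleRatio]
        field_simp
        norm_num
      rw [h5]
      have := mul_le_mul_of_nonneg_left hpL
        (show 0 ≤ 153600 * (z : ℝ) ^ 2 * ε⁻¹ ^ 2 by positivity)
      linarith
    have h5 : scaleRatio k z ε ^ z ≤
        460800 ^ z * (z : ℝ) ^ (2 * z) * (ε⁻¹ ^ (2 * z) * logTerm k m ε ^ z) := by
      refine (pow_le_pow_left₀ hB.le h4 z).trans (le_of_eq ?_)
      rw [mul_pow, mul_pow, mul_pow, ← pow_mul, ← pow_mul]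
      ring
    have hY1 : 1 ≤ ε⁻¹ ^ (2 * z) * logTerm k m ε ^ z :=
      one_le_mul_of_one_le_of_one_le (one_le_pow₀ ((one_le_inv₀ hε).2 hε'.le)) (one_le_pow₀ hL)
    set Y := ε⁻¹ ^ (2 * z) * logTerm k m ε ^ z with hY
    have h6 : 2 * (460800 ^ z * (z : ℝ) ^ (2 * z)) ≤ c * (z : ℝ) ^ (c * z) := by
      have h8 := pow_le_mul_pow (K := 460800) hz (by norm_num) (by norm_num)
      have h9 : (z : ℝ) ^ (21 * z) ≤ (z : ℝ) ^ (c * z) :=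
        pow_le_pow_right₀ hz' (Nat.mul_le_mul_right z (by rw [hc]; norm_num))
      have h10 : (0 : ℝ) ≤ (z : ℝ) ^ (c * z) := by positivity
      calc 2 * (460800 ^ z * (z : ℝ) ^ (2 * z))
          ≤ 2 * (460800 * (z : ℝ) ^ (19 * z) * (z : ℝ) ^ (2 * z)) := by
            have := mul_le_mul_of_nonneg_right h8 (show (0 : ℝ) ≤ (z : ℝ) ^ (2 * z) by positivity)
            linarith
        _ = 921600 * (z : ℝ) ^ (21 * z) := by
            rw [mul_assoc 460800, ← pow_add, ← add_mul]
            ring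
        _ ≤ 921600 * (z : ℝ) ^ (c * z) := by linarith
        _ ≤ c * (z : ℝ) ^ (c * z) := mul_le_mul_of_nonneg_right (by rw [hcR]; norm_num) h10
    have h7 : 1 ≤ 460800 ^ z * (z : ℝ) ^ (2 * z) :=
      one_le_mul_of_one_le_of_one_le (one_le_pow₀ (by norm_num)) (one_le_pow₀ hz')
    set Z := 460800 ^ z * (z : ℝ) ^ (2 * z)
    have h8 : (m : ℝ) + m * scaleRatio k z ε ^ z ≤ c * (z : ℝ) ^ (c * z) * (m * Y) := by
      have hZY : 1 ≤ Z * Y := one_le_mul_of_one_le_of_one_le h7 hY1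
      have h9 : (m : ℝ) + m * scaleRatio k z ε ^ z ≤ m * (2 * (Z * Y)) := by
        have := mul_le_mul_of_nonneg_left (add_le_add hZY h5) (show (0 : ℝ) ≤ m by linarith)
        linarith
      have h10 := mul_le_mul_of_nonneg_right h6 (show 0 ≤ m * Y by positivity)
      linarith
    rw [hY] at h8
    rw [mul_assoc (m : ℝ)]
    linarith

end Constructions

/-! ### The algorithm -/

section Search

variable {E : Type*} {n d : ℕ} {orc : E → Construction} {K : Set (E → ℝ)}
  {R : E → (Fin n → ℝ) → Prop}

/-- `G` is fixed while the tree is built, hence so is the number of points passed to the oracle. -/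
theorem Solves.subWeights {D : ℕ} (k : ℕ) (ε : ℝ) (G : Finset (Fin n))
    (y : E → Fin n → EuclideanSpace ℝ (Fin D)) (hy : ∀ i j, Computable K fun e => y e i j)
    (h : Solves orc (K ∪ Set.range fun i e => subWeights (orc e) D k ε G (y e) i) R) :
    Solves orc K R := by
  refine .call k ε (fun t e => y e (G.equivFin.symm t)) (fun t j => hy _ j) ?_
  refine .computable_range (f := fun i e => RobustCoreset.subWeights (orc e) D k ε G (y e) i)
    (fun i => ?_) (h.mono (Set.union_subset_union_left _ Set.subset_union_left))
  by_cases hi : i ∈ G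
  · refine .of_mem (.inr ⟨G.equivFin ⟨i, hi⟩, ?_⟩)
    funext e
    rw [RobustCoreset.subWeights, dif_pos hi]
  · have : (fun e => RobustCoreset.subWeights (orc e) D k ε G (y e) i) = fun _ => 0 := by
      funext e
      rw [RobustCoreset.subWeights, dif_neg hi]
    exact this ▸ .const 0

theorem computable_rescale {k : ℕ} (G : Finset (Fin n)) (lab : Fin n → Fin k)
    {v : E → Fin n → ℝ} (hv : ∀ i, Computable K fun e => v e i) (i : Fin n) :
    Computable K fun e => rescale G lab (v e) i := by
  by_cases hi : i ∈ G
  · simp only [rescale, if_pos hi]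
    exact (hv i).mul ((Computable.const _).div (.sum _ fun j _ => hv j))
  · simp only [rescale, if_neg hi]
    exact .const 1

theorem computable_extendByOne (G : Finset (Fin n))
    {v : E → Fin n → ℝ} (hv : ∀ i, Computable K fun e => v e i) (i : Fin n) :
    Computable K fun e => extendByOne G (v e) i := by
  by_cases hi : i ∈ G
  · simp only [extendByOne, if_pos hi]
    exact hv i
  · simp only [extendByOne, if_neg hi]
    exact .const 1

/-- An algorithm can return the smaller one of two weighted sets. -/
theorem Solves.min_size {w₁ w₂ : E → Fin n → ℝ} (h₁ : ∀ i, Computable K fun e => w₁ e i)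
    (h₂ : ∀ i, Computable K fun e => w₂ e i)
    (hR₁ : ∀ e, size (w₁ e) ≤ size (w₂ e) → R e (w₁ e))
    (hR₂ : ∀ e, size (w₂ e) ≤ size (w₁ e) → R e (w₂ e)) : Solves orc K R := by
  classical
  have hsize : ∀ (w : Fin n → ℝ) (S : Finset (Fin n)), (∀ i, i ∈ S ↔ ¬ w i = 0) →
      size w = S.card := fun w S hS => by
    rw [size, ← Set.ncard_coe_finset]
    congr 1
    ext i
    simp [hS]
  -- Each branch of the search knows both supports, so the comparison of their sizes needs no
  -- instruction.
  refine .search (β := Finset (Fin n) × Finset (Fin n))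
    (Q := fun S e => (∀ i, i ∈ S.1 ↔ ¬ w₁ e i = 0) ∧ ∀ i, i ∈ S.2 ↔ ¬ w₂ e i = 0)
    (fun S => (Testable.forall fun i => (Testable.const _).iff (Testable.eq (h₁ i) (.const 0)).not).and
      (Testable.forall fun i => (Testable.const _).iff (Testable.eq (h₂ i) (.const 0)).not))
    (fun e => ⟨(Finset.univ.filter fun i => ¬ w₁ e i = 0, Finset.univ.filter fun i => ¬ w₂ e i = 0),
      by simp⟩) fun S => ?_
  by_cases hS : S.1.card ≤ S.2.card
  · refine .output (fun i e => w₁ e i) h₁ fun e he => hR₁ e ?_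
    rwa [hsize _ _ he.1, hsize _ _ he.2]
  · refine .output (fun i e => w₂ e i) h₂ fun e he => hR₂ e ?_
    rw [hsize _ _ he.1, hsize _ _ he.2]
    exact (not_le.1 hS).le

variable {k m z : ℕ} {ε ρ : ℝ} {x : E → Fin n → EuclideanSpace ℝ (Fin d)}

theorem computable_dist (hx : ∀ i j, Computable K fun e => x e i j)
    (i j : Fin n) : Computable K fun e => dist (x e i) (x e j) := by
  simp only [EuclideanSpace.dist_eq, Real.dist_eq, sq_abs]
  exact .sqrt (.sum _ fun t _ => ((hx i t).sub (hx j t)).pow 2)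

theorem computable_assignCost (hx : ∀ i j, Computable K fun e => x e i j)
    (b : (Fin k → Fin n) × (Fin n → Fin k) × Finset (Fin n)) :
    Computable K fun e => assignCost z (x e) b :=
  .sum _ fun i _ => (computable_dist hx i _).pow z

theorem testable_isOptimal (hx : ∀ i j, Computable K fun e => x e i j)
    (b : (Fin k → Fin n) × (Fin n → Fin k) × Finset (Fin n)) :
    Testable n orc K fun e => IsOptimal z m (x e) b :=
  (Testable.const _).and (.forall fun b' => (Testable.const _).imp
    (.le (computable_assignCost hx b) (computable_assignCost hx b')))

theorem testable_forall_isCore (hx : ∀ i j, Computable K fun e => x e i j)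
    (b : (Fin k → Fin n) × (Fin n → Fin k) × Finset (Fin n))
    (G : Finset (Fin n)) : Testable n orc K fun e => ∀ i, i ∈ G ↔ IsCore z ρ (x e) b i :=
  .forall fun i => (Testable.const _).iff ((Testable.const _).and
    (.le ((computable_dist hx i _).pow z) ((Computable.const ρ).mul (computable_assignCost hx b))))

theorem testable_isSparse (hx : ∀ i j, Computable K fun e => x e i j)
    (b : (Fin k → Fin n) × (Fin n → Fin k) × Finset (Fin n))
    (π : Fin k → Fin k) (col : Fin k → Fin (numColors k)) :
    Testable n orc K fun e => IsSparse m z ε (x e) b π col := by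
  refine .and (.forall fun Q => ?_) (.forall fun Q => .forall fun Q' => ?_)
  · exact .le ((computable_dist hx _ _).pow z)
      ((Computable.const _).mul (computable_assignCost hx b))
  · exact (Testable.const _).imp (.imp (.le ((computable_dist hx _ _).pow z)
      ((Computable.const _).mul (computable_assignCost hx b))) (.const _))

theorem computable_liftedPoints (hx : ∀ i j, Computable K fun e => x e i j)
    (D : ℕ) (lab : Fin n → Fin k) (i : Fin n) (t : Fin D) :
    Computable K fun e => liftedPoints D z ε (x e) lab i t := by
  have hH : Computable K fun e => liftHeight z ε (x e) :=
    (Computable.const _).mul ((Computable.const 1).add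
      (.sum _ fun i _ => .sum _ fun j _ => computable_dist hx i j))
  simp only [liftedPoints, liftPoint]
  by_cases h1 : (t : ℕ) < d
  · simp only [dif_pos h1]
    exact hx i _
  · simp only [dif_neg h1]
    by_cases h2 : (t : ℕ) = d
    · simp only [if_pos h2]
      exact hH.mul (.const _)
    · simp only [if_neg h2]
      exact .const 0

end Search

theorem load_apply {n d : ℕ} (x : Fin n → EuclideanSpace ℝ (Fin d)) (i : Fin n) (j : Fin d) :
    load x (finProdFinEquiv (i, j)) = x i j := by
  rw [load, dif_pos (finProdFinEquiv (i, j)).2, Fin.eta, Equiv.symm_apply_apply]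

theorem exists_algorithm {c : ℕ} (hc : c = 10 ^ 6) {d k z m n : ℕ} {ε : ℝ} (hd : 1 ≤ d)
    (hk : 1 ≤ k) (hz : 1 ≤ z) (hm : 1 ≤ m) (hε : 0 < ε) (hε' : ε < 1) [Nonempty (Fin n)] :
    ∃ P : Algorithm n, ∀ (N : ℕ → ℕ → ℝ → ℝ) (A : Construction), IsVanillaConstruction z N A →
      ∀ x : Fin n → EuclideanSpace ℝ (Fin d), Function.Injective x →
        IsCoreset k z m ε x (P.run A (load x)) ∧
          (size (P.run A (load x)) : ℝ) ≤
            min (sizeBound₁ c N d k z m ε) (sizeBound₂ c N d k z m ε) := by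
  classical
  -- An environment bundles `N`, the oracle and the dataset with their hypotheses, so a single tree
  -- serves them all.
  let E : Type := {e : (ℕ → ℕ → ℝ → ℝ) × Construction × (Fin n → EuclideanSpace ℝ (Fin d)) //
    IsVanillaConstruction z e.1 e.2.1 ∧ Function.Injective e.2.2}
  let orc : E → Construction := fun e => e.1.2.1
  let x : E → Fin n → EuclideanSpace ℝ (Fin d) := fun e => e.1.2.2
  let K : Set (E → ℝ) := Set.range fun (ij : Fin n × Fin d) e => x e ij.1 ij.2
  let R : E → (Fin n → ℝ) → Prop := fun e o => IsCoreset k z m ε (x e) o ∧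
    (size o : ℝ) ≤ min (sizeBound₁ c e.1.1 d k z m ε) (sizeBound₂ c e.1.1 d k z m ε)
  suffices H : Solves orc K R by
    obtain ⟨P, hP⟩ := H (n * d) (fun q e => load (x e) q) (by
      rintro _ ⟨⟨i, j⟩, rfl⟩
      refine ⟨finProdFinEquiv (i, j), (finProdFinEquiv (i, j)).2, ?_⟩
      exact funext fun e => load_apply (x e) i j)
    exact ⟨P, fun N A hA x hx => hP ⟨(N, A, x), hA, hx⟩ _ fun _ _ => rfl⟩
  have hx : ∀ i j, Computable K fun e => x e i j := fun i j => .of_mem ⟨(i, j), rfl⟩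
  have hxK : ∀ {K' : Set (E → ℝ)}, K ⊆ K' → ∀ i j, Computable K' fun e => x e i j :=
    fun hK i j => (hx i j).mono hK
  -- All combinatorial data are found at once; the large clusters and the labels are functions of
  -- them and need no test.
  refine .search (β := ((Fin k → Fin n) × (Fin n → Fin k) × Finset (Fin n)) ×
      (Finset (Fin n) × Finset (Fin n)) × (Fin k → Fin k) × (Fin k → Fin (numColors k)))
    (Q := fun β e => IsOptimal z m (x e) β.1 ∧
      (∀ i, i ∈ β.2.1.1 ↔ IsCore z (ε / (20 * 6 ^ z * m)) (x e) β.1 i) ∧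
      (∀ i, i ∈ β.2.1.2 ↔ IsCore z (coreRatio k z m ε) (x e) β.1 i) ∧
      IsSparse m z ε (x e) β.1 β.2.2.1 β.2.2.2)
    (fun β => (testable_isOptimal hx _).and ((testable_forall_isCore hx _ _).and
      ((testable_forall_isCore hx _ _).and (testable_isSparse hx _ _ _))))
    (fun e => ?_) ?_
  · obtain ⟨b, hb⟩ := exists_isOptimal hk z m (x e)
    obtain ⟨π, col, hπ⟩ := exists_isSparse hz hm hε (x e) b
    exact ⟨(b, (Finset.univ.filter fun i => IsCore z (ε / (20 * 6 ^ z * m)) (x e) b i,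
      Finset.univ.filter fun i => IsCore z (coreRatio k z m ε) (x e) b i), π, col), hb,
      by simp, by simp, hπ⟩
  rintro ⟨b, ⟨G, G₂⟩, π, col⟩
  obtain ⟨G₁, hG₁⟩ : ∃ G₁, G₁ = largeClusters (10 * 3 ^ z * m / ε) b.2.1 G := ⟨_, rfl⟩
  obtain ⟨k', hk'⟩ : ∃ k', k' = ⌈(c : ℝ) * k * logTerm k m ε ^ 2⌉₊ := ⟨_, rfl⟩
  obtain ⟨lab, hlab⟩ : ∃ lab : Fin n → Fin k, ∀ i, lab i = π (b.2.1 i) := ⟨_, fun _ => rfl⟩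
  refine .subWeights k (ε / c) G₁ x hx ?_
  refine .subWeights k' (ε / c) G₂ (fun e => liftedPoints (c * d) z ε (x e) lab)
    (computable_liftedPoints (hxK Set.subset_union_left) _ _) ?_
  refine .min_size
    (w₁ := fun e => extendByOne G₁ (subWeights (orc e) d k (ε / c) G₁ (x e)))
    (w₂ := fun e => rescale G₂ lab
      (subWeights (orc e) (c * d) k' (ε / c) G₂ (liftedPoints (c * d) z ε (x e) lab)))
    (computable_extendByOne _ fun i => .of_mem (.inl (.inr ⟨i, rfl⟩)))
    (computable_rescale _ _ fun i => .of_mem (.inr ⟨i, rfl⟩)) ?_ ?_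
  all_goals
    rintro e hle ⟨hb, hG, hG₂, hπ⟩
    have h₁ := isCoreset_of_largeClusters hc hd hk hz hm hε hε' e.2.1 e.2.2 hb hG hG₁
    have h₂ := isCoreset_of_isSparse hc hk' hd hk hz hm hε hε' e.2.1 e.2.2 hb hG₂ hπ hlab
    have hle' := (Nat.cast_le (α := ℝ)).2 hle
  · exact ⟨h₁.1, le_min h₁.2 (hle'.trans h₂.2)⟩
  · exact ⟨h₂.1, le_min (hle'.trans h₁.2) h₂.2⟩

/-- The empty dataset is separate since it has no points to serve as centers. All weight functions
coincide there. -/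
theorem exists_algorithm_of_isEmpty {c : ℕ} (hc : c = 10 ^ 6) {d k z m : ℕ} {ε : ℝ} (hd : 1 ≤ d)
    (hk : 1 ≤ k) (hε : 0 < ε) (hε' : ε < 1) :
    ∃ P : Algorithm 0, ∀ (N : ℕ → ℕ → ℝ → ℝ) (A : Construction), IsVanillaConstruction z N A →
      ∀ x : Fin 0 → EuclideanSpace ℝ (Fin d), Function.Injective x →
        IsCoreset k z m ε x (P.run A (load x)) ∧
          (size (P.run A (load x)) : ℝ) ≤
            min (sizeBound₁ c N d k z m ε) (sizeBound₂ c N d k z m ε) := by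
  refine ⟨.halt Fin.elim0, fun N A hA x _ => ⟨⟨fun i => i.elim0, fun C h hh _ => ?_⟩, ?_⟩⟩
  · rw [Subsingleton.elim ((Algorithm.halt Fin.elim0).run A (load x)) fun _ => 1]
    have := robustCost_nonneg (z := z) (x := x) (C := C) (w := fun _ => 1)
      (fun _ => zero_le_one) hh
    constructor <;> nlinarith
  · have hcR : (c : ℝ) = 10 ^ 6 := by rw [hc]; norm_num
    -- `N` is nonnegative at these arguments because it bounds the size of a coreset of the empty
    -- dataset.
    have hN : ∀ d' k', 1 ≤ d' → 1 ≤ k' → 0 ≤ N d' k' (c * ε⁻¹) := fun d' k' hd' hk' => by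
      have := (hA d' k' (ε / c) hd' hk' (by rw [hcR]; positivity)
        (by rw [hcR, div_lt_one (by norm_num)]; linarith) 0 (fun i => i.elim0)
        fun i => i.elim0).2
      rw [inv_div, div_eq_mul_inv] at this
      exact (Nat.cast_nonneg _).trans this
    have h0 : size ((Algorithm.halt Fin.elim0).run A (load x)) = 0 := by
      rw [size, Set.ncard_eq_zero]
      exact Set.eq_empty_of_isEmpty _
    have hL := one_le_logTerm k m ε
    rw [h0, Nat.cast_zero]
    refine le_min (add_nonneg (hN d k hd hk) (by positivity)) (add_nonneg (hN _ _ ?_ ?_) ?_)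
    · rw [hc]
      omega
    · rw [Nat.one_le_ceil_iff, hcR]
      positivity
    · positivity

end

end RobustCoreset

theorem theorem1p1 :
    ∃ c : ℕ, ∀ (d k z m n : ℕ) (ε : ℝ), 1 ≤ d → 1 ≤ k → 1 ≤ z → 1 ≤ m → 0 < ε → ε < 1 →
      ∃ P : RobustCoreset.Algorithm n,
        ∀ (N : ℕ → ℕ → ℝ → ℝ) (A : RobustCoreset.Construction),
          RobustCoreset.IsVanillaConstruction z N A →
          ∀ x : Fin n → EuclideanSpace ℝ (Fin d), Function.Injective x →
            RobustCoreset.IsCoreset k z m ε x (P.run A (RobustCoreset.load x)) ∧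
              (RobustCoreset.size (P.run A (RobustCoreset.load x)) : ℝ) ≤
                min (RobustCoreset.sizeBound₁ c N d k z m ε)
                  (RobustCoreset.sizeBound₂ c N d k z m ε) := by
  -- The most demanding constant is `921600 = 2 * 460800` in the second size bound.
  obtain ⟨c, hc⟩ : ∃ c : ℕ, c = 10 ^ 6 := ⟨_, rfl⟩
  refine ⟨c, fun d k z m n ε hd hk hz hm hε hε' => ?_⟩
  rcases Nat.eq_zero_or_pos n with rfl | hn
  · exact RobustCoreset.exists_algorithm_of_isEmpty hc hd hk hε hε'
  · have : Nonempty (Fin n) := ⟨⟨0, hn⟩⟩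
    exact RobustCoreset.exists_algorithm hc hd hk hz hm hε hε'
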